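/- **Setting.** Let $\mathcal A$ be a finite set of basic actions, $\delta\notin\mathcal A$, and $\gamma$ a commutative and associative function on $\mathcal A\cup\{\delta\}$ with $\gamma(\delta,a)=\delta$. Let $\Sigma$ be a many-sorted signature with sorts $\mathbf D$ (data) and $\mathbf B$ (bits) and constants $0,1$ of sort $\mathbf B$, and let $\mathfrak D$ be a minimal $\Sigma$-algebra whose carrier of sort $\mathbf D$ is non-empty and whose carrier of sort $\mathbf B$ has two elements, with $0\neq 1$. Let $\mathcal V$ be a finite or countably infinite set of flexible variables. A *valuation* is a map $\rho$ from $\mathcal V$ to the closed $\Sigma$-terms of sort $\mathbf D$; $\rho(e)$, $\rho(\phi)$ denote the results of replacing each $v\in\mathcal V$ by $\rho(v)$. Closed data terms and closed conditions may contain flexible variables; conditions are built from equations between data terms and between bit terms by $\bot,\neg,\vee$ and $\exists$ over $\mathbf D$. $\mathfrak D\models\phi$ means that $\phi$ holds in $\mathfrak D$ under every assignment of data to its free variables (flexible variables included). **Processes.** Closed process terms are built from $\delta$, $\varepsilon$, actions $a(e_1,\dots,e_n)$ ($n\ge 0$; $a()$ is the basic action $a$) and assignments $v:=e$ by $+$,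 $\cdot$, iteration ${}^*$, $\parallel$, left merge, communication merge $\mid$, encapsulation $\partial_H$ ($H\subseteq\mathcal A$), guarding $\phi{:}{\to}\,$ ($\phi$ a closed condition), and evaluation $V_\rho$. Termination $p{\downarrow_\rho}$ and transitions $p\xrightarrow{\rho,\alpha}p'$ are the least relations closed under the usual rules of ACP with $\varepsilon$ and iteration ($\alpha\xrightarrow{\rho,\alpha}\varepsilon$; $\varepsilon{\downarrow_\rho}$; $x^*y$ behaves as $y$ or performs a step of $x$ to $x'$ and continues as $x'\cdot(x^*y)$; $x\parallel y$ terminates if both do and interleaves; from steps $a(\vec e)$ of $x$ and $b(\vec e')$ of $y$, with $\vec e,\vec e'$ of equal length, it has a joint step $c(\vec e)$ if $\gamma(a,b)=c\in\mathcal A$ and $\mathfrak D\models\rho(e_i)=\rho(e'_i)$ for all $i$; $\partial_H$ blocks only actions $a(\vec e)$ with $a\in H$), together with: $\phi{:}{\to}\,x$ behaves under $\rho$ as $x$ does if $\mathfrak D\models\rho(\phi)$ and cannot do anything otherwise; under every $\rho'$, $V_\rho(x)$ terminates if $x{\downarrow_\rho}$, it has a step $a(\rho(\vec e))$ to $V_\rho(x')$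 if $x\xrightarrow{\rho,a(\vec e)}x'$, and a step $v:=\rho(e)$ to $V_{\rho[\rho(e)/v]}(x')$ if $x\xrightarrow{\rho,v:=e}x'$. Two closed process terms are equal as processes if they are related by a relation $B$ such that related terms terminate under the same valuations and, under each valuation, each step of one is matched by a step of the other with the same action, up to $\mathfrak D$-equality of its data terms, to $B$-related terms. Let $\mathcal P$ be the set of closed process terms without $V_\rho$, left merge and $\mid$. **Asserted processes.** Pre- and post-conditions are conditions with flexible variables and free data variables; rely- and guarantee-conditions may in addition contain a previous-value variable $\overline v$ for each $v\in\mathcal V$; $\overline\phi$, $\overline e$ are $\phi$, $e$ with each $v$ replaced by $\overline v$. An *asserted process* is $\langle R,G\rangle:\{\phi\}\,p\,\{\psi\}$ with $p\in\mathcal P$, $\phi,\psi$ of the former and $R,G$ of the latter kind. For a finite $W\subseteq\mathcal V$ let $\mathrm{unch}(W)=\bigwedge_{v\in W}v=\overline v$, and let $FV(\cdot)$ be the set of $v$ such that $v$ or $\overline v$ occurs. A set $A\subseteq\mathcal V$ of flexible variables that occur in $p$ is a set of *auxiliary variables* of $p$ if they occur in $p$ only inside subterms $v:=e$ with $v\in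 A$; $p_A$ is $p$ with each subterm $v:=e$ with $v\in A$ replaced by $\varepsilon$, and $\chi_A$ is $\exists v_1\cdots\exists v_n\,\chi$ for $A=\{v_1,\dots,v_n\}$ (the $\overline v_i$ are not bound). The logic RG has the following axiom and rules. * Inaction: $\langle R,G\rangle:\{\phi\}\,\delta\,\{\psi\}$. * Empty process: from $\mathfrak D\models\overline\phi\wedge R\to\phi$ infer $\langle R,G\rangle:\{\phi\}\,\varepsilon\,\{\phi\}$. * Non-assignment action: from $\mathfrak D\models\overline\phi\wedge R\to\phi$ and $\mathfrak D\models\overline\phi\wedge\mathrm{unch}(FV(\phi,G))\to G$ infer $\langle R,G\rangle:\{\phi\}\,a(e_1,\dots,e_n)\,\{\phi\}$. * Assignment: from $\mathfrak D\models\phi\to\psi[e/v]$, $\mathfrak D\models\overline\phi\wedge R\to\phi$, $\mathfrak D\models\overline\psi\wedge R\to\psi$ and $\mathfrak D\models\overline\phi\wedge(v=\overline e\vee v=\overline v)\wedge\mathrm{unch}(FV(\phi,G)\setminus\{v\})\to G$ infer $\langle R,G\rangle:\{\phi\}\,v:=e\,\{\psi\}$. * Alternative composition: from $\langle R,G\rangle:\{\phi\}\,p\,\{\psi\}$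 and $\langle R,G\rangle:\{\phi\}\,q\,\{\psi\}$ infer $\langle R,G\rangle:\{\phi\}\,p+q\,\{\psi\}$. * Sequential composition: from $\langle R,G\rangle:\{\phi\}\,p\,\{\chi\}$ and $\langle R,G\rangle:\{\chi\}\,q\,\{\psi\}$ infer $\langle R,G\rangle:\{\phi\}\,p\cdot q\,\{\psi\}$. * Iteration: from $\langle R,G\rangle:\{\phi\}\,p\,\{\phi\}$ and $\langle R,G\rangle:\{\phi\}\,q\,\{\psi\}$ infer $\langle R,G\rangle:\{\phi\}\,p^*q\,\{\psi\}$. * Guarded command: from $\mathfrak D\models\overline\phi\wedge R\to\phi$ and $\langle R,G\rangle:\{\phi\wedge\chi\}\,p\,\{\psi\}$ infer $\langle R,G\rangle:\{\phi\}\,\chi{:}{\to}\,p\,\{\psi\}$. * Parallel composition: from $\langle R\vee G'',G'\rangle:\{\phi\}\,p\,\{\psi'\}$ and $\langle R\vee G',G''\rangle:\{\phi\}\,q\,\{\psi''\}$ infer $\langle R,G'\vee G''\rangle:\{\phi\}\,p\parallel q\,\{\psi'\wedge\psi''\}$. * Encapsulation: from $\langle R,G\rangle:\{\phi\}\,p\,\{\psi\}$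 infer $\langle R,G\rangle:\{\phi\}\,\partial_H(p)\,\{\psi\}$. * Auxiliary variables: if $A$ is a set of auxiliary variables of $p$ with $FV(\phi,\psi,R,G)\cap A=\emptyset$, from $\mathfrak D\models\overline\phi\wedge R\to\phi$, $\mathfrak D\models\phi'_A$, $\mathfrak D\models R'_A$ and $\langle R\wedge R',G\rangle:\{\phi\wedge\phi'\}\,p\,\{\psi\}$ infer $\langle R,G\rangle:\{\phi\}\,p_A\,\{\psi\}$. * Consequence: from $\mathfrak D\models\phi\to\phi'$, $\mathfrak D\models R\to R'$, $\mathfrak D\models G'\to G$, $\mathfrak D\models\psi'\to\psi$ and $\langle R',G'\rangle:\{\phi'\}\,p\,\{\psi'\}$ infer $\langle R,G\rangle:\{\phi\}\,p\,\{\psi\}$. **Truth.** A *computation* of $p\in\mathcal P$ is a finite sequence of steps $(p_1,\rho_1)\xrightarrow{l_1}(p_2,\rho_2)\cdots\xrightarrow{l_n}(p_{n+1},\rho_{n+1})$, $n\ge 0$, with $p_1=p$ and all $p_i\in\mathcal P$, in which each step is either a program step, with $l_i=\alpha$ an action such that $V_{\rho_i}(p_i)\xrightarrow{\rho'',\alpha}V_{\rho_{i+1}}(p_{i+1})$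 for all valuations $\rho''$, or an environment step, with $p_{i+1}=p_i$ and $\rho_{i+1}$ arbitrary. Write $[\rho_{i+1},\rho_i]$ for the substitution of $\rho_{i+1}(v)$ for $v$ and of $\rho_i(v)$ for $\overline v$. The asserted process $\langle R,G\rangle:\{\phi\}\,p\,\{\psi\}$ is *true in the sense of partial correctness* if, for every simultaneous substitution of closed $\Sigma$-terms for the data variables, giving $R',G',\phi',\psi'$, and every computation of $p$ as above: if $\mathfrak D\models\rho_1(\phi')$ and $\mathfrak D\models[\rho_{i+1},\rho_i](R')$ for every environment step, then $\mathfrak D\models[\rho_{i+1},\rho_i](G')$ for every program step, and $\mathfrak D\models\rho_{n+1}(\psi')$ if $p_{n+1}$ equals $\varepsilon$ as a process. **Theorem (Soundness).** For all $p\in\mathcal P$, all pre- and post-conditions $\phi,\psi$ and all rely- and guarantee-conditions $R,G$: if $\langle R,G\rangle:\{\phi\}\,p\,\{\psi\}$ is derivable in RG, then it is true in the sense of partial correctness. -/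

import Mathlib

/-! ## Data: many-sorted signatures, algebras, terms and conditions -/

namespace ImpProc

universe u v

/-- A many-sorted signature of data. `Op l s` is the set of operators with argument sorts `l` and
result sort `s` (constants are operators with `l = []`). It includes two distinct sorts `data` and
`bool`, and two constants `zero`, `one` of sort `bool`. -/
structure DataSig where
  Srt : Type u
  Op : List Srt → Srt → Type u
  data : Srt
  bool : Srt
  data_ne_bool : data ≠ bool
  zero : Op [] bool
  one : Op [] bool

/-- Many-sorted terms over `S` whose leaves of sort `data` are taken from `X`
(either variables of sort `data`, or additional constants of sort `data`, or both).
In particular `Tm S Empty s` is the set of closed terms of sort `s` over the signature. -/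
inductive Tm (S : DataSig.{u}) (X : Type) : S.Srt → Type u
  | var (x : X) : Tm S X S.data
  | op {l : List S.Srt} {s : S.Srt} (o : S.Op l s)
      (args : ∀ i : Fin l.length, Tm S X (l.get i)) : Tm S X s

/-- Simultaneous substitution of terms for leaves. -/
def Tm.subst {S : DataSig.{u}} {X Y : Type} (f : X → Tm S Y S.data) :
    {s : S.Srt} → Tm S X s → Tm S Y s
  | _, .var x => f x
  | _, .op o args => .op o (fun i => (args i).subst f)

/-- Renaming of leaves. -/
def Tm.rename {S : DataSig.{u}} {X Y : Type} (f : X → Y) {s : S.Srt} (t : Tm S X s) : Tm S Y s :=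
  t.subst (fun x => .var (f x))

open Classical in
/-- The set of leaves that occur in a term. -/
noncomputable def Tm.leaves {S : DataSig.{u}} {X : Type} : {s : S.Srt} → Tm S X s → Finset X
  | _, .var x => {x}
  | _, .op _ args => Finset.univ.biUnion (fun i => (args i).leaves)

/-- Evaluation of a term in an algebra given by carriers and operations, under an assignment of
elements of the carrier of sort `data` to the leaves. -/
def Tm.evalIn {S : DataSig.{u}} {X : Type} {C : S.Srt → Type v}
    (I : ∀ {l : List S.Srt} {s : S.Srt}, S.Op l s → (∀ i : Fin l.length, C (l.get i)) → C s)
    (env : X → C S.data) : {s : S.Srt} → Tm S X s → C s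
  | _, .var x => env x
  | _, .op o args => I o (fun i => (args i).evalIn I env)

/-- A minimal algebra of the signature `S` (every element of every carrier is denoted by a closed
term), with a nonempty carrier of sort `data` and a two-element carrier of sort `bool` in which
`zero` and `one` denote different elements. -/
structure DataAlg (S : DataSig.{u}) where
  carrier : S.Srt → Type v
  interp : ∀ {l : List S.Srt} {s : S.Srt},
    S.Op l s → (∀ i : Fin l.length, carrier (l.get i)) → carrier s
  minimal : ∀ (s : S.Srt) (x : carrier s), ∃ t : Tm S Empty s, t.evalIn interp Empty.elim = x
  data_nonempty : Nonempty (carrier S.data)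
  bool_card : Nat.card (carrier S.bool) = 2
  zero_ne_one : interp S.zero (fun i => i.elim0) ≠ interp S.one (fun i => i.elim0)

/-- Terms of sort condition whose leaves of sort `data` are taken from `X`.
`ex` is existential quantification over `data`: the leaf `none` is the variable that it binds,
and `some x` is the leaf `x` of the surrounding condition. There are no variables of sort
condition. -/
inductive Cond (S : DataSig.{u}) : Type → Type (max u 1)
  | eqBool {X : Type} (t t' : Tm S X S.bool) : Cond S X
  | eqData {X : Type} (t t' : Tm S X S.data) : Cond S X
  | fls {X : Type} : Cond S X
  | neg {X : Type} (φ : Cond S X) : Cond S X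
  | or {X : Type} (φ ψ : Cond S X) : Cond S X
  | ex {X : Type} (φ : Cond S (Option X)) : Cond S X

namespace Cond

variable {S : DataSig.{u}}

/-- `⊤` stands for `¬ ⊥`. -/
def tru {X : Type} : Cond S X := .neg .fls

/-- `φ ∧ ψ` stands for `¬ (¬ φ ∨ ¬ ψ)`. -/
def and {X : Type} (φ ψ : Cond S X) : Cond S X := .neg (.or (.neg φ) (.neg ψ))

/-- `φ → ψ` stands for `¬ φ ∨ ψ`. -/
def imp {X : Type} (φ ψ : Cond S X) : Cond S X := .or (.neg φ) ψ

/-- Capture-avoiding simultaneous substitution of terms for the (free) leaves. -/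
def subst : {X Y : Type} → (X → Tm S Y S.data) → Cond S X → Cond S Y
  | _, _, f, .eqBool t t' => .eqBool (t.subst f) (t'.subst f)
  | _, _, f, .eqData t t' => .eqData (t.subst f) (t'.subst f)
  | _, _, _, .fls => .fls
  | _, _, f, .neg φ => .neg (φ.subst f)
  | _, _, f, .or φ ψ => .or (φ.subst f) (ψ.subst f)
  | _, _, f, .ex φ => .ex (φ.subst (fun o => o.elim (.var none) (fun x => (f x).rename some)))

/-- Renaming of the (free) leaves. -/
def rename {X Y : Type} (f : X → Y) (φ : Cond S X) : Cond S Y :=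
  φ.subst (fun x => .var (f x))

/-- The set of (free) leaves that occur in a condition. -/
noncomputable def leaves : {X : Type} → Cond S X → Finset X
  | _, .eqBool t t' => by classical exact t.leaves ∪ t'.leaves
  | _, .eqData t t' => by classical exact t.leaves ∪ t'.leaves
  | _, .fls => ∅
  | _, .neg φ => φ.leaves
  | _, .or φ ψ => by classical exact φ.leaves ∪ ψ.leaves
  | _, .ex φ => Finset.eraseNone φ.leaves

/-- Satisfaction of a condition in `D` under an assignment of data to its leaves. -/
def Sat (D : DataAlg.{u, v} S) : {X : Type} → (X → D.carrier S.data) → Cond S X → Prop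
  | _, env, .eqBool t t' => t.evalIn D.interp env = t'.evalIn D.interp env
  | _, env, .eqData t t' => t.evalIn D.interp env = t'.evalIn D.interp env
  | _, _, .fls => False
  | _, env, .neg φ => ¬ φ.Sat D env
  | _, env, .or φ ψ => φ.Sat D env ∨ ψ.Sat D env
  | _, env, .ex φ => ∃ d : D.carrier S.data, φ.Sat D (fun o => o.elim d env)

/-- Existential quantification over a given leaf `x` (taken as a variable): `∃ x, φ`. -/
noncomputable def exLeaf {X : Type} (x : X) (φ : Cond S X) : Cond S X :=
  .ex (φ.subst (fun y => by classical exact if y = x then .var none else .var (some y)))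

/-- `∃ x₁, … ∃ xₙ, φ`, where `x₁, …, xₙ` is the list `xs`. -/
noncomputable def exLeaves {X : Type} (xs : List X) (φ : Cond S X) : Cond S X :=
  xs.foldr exLeaf φ

end Cond

/-- `D ⊨ φ`: the condition holds in `D`, i.e. under every assignment of data to its leaves. -/
def DataAlg.Holds {S : DataSig.{u}} (D : DataAlg.{u, v} S) {X : Type} (φ : Cond S X) : Prop :=
  ∀ env : X → D.carrier S.data, φ.Sat D env

section Terms

variable (S : DataSig.{u}) (Flex : Type)

/-- Closed terms of sort `data` over the signature. -/
abbrev DataVal := Tm S Empty S.data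

/-- Closed terms of sort `data` of the process algebra: flexible variables may occur in them. -/
abbrev DataTerm := Tm S Flex S.data

/-- Closed terms of sort condition of the process algebra. -/
abbrev CondTerm := Cond S Flex

/-- Flexible variable valuations. -/
abbrev Val := Flex → DataVal S

/-- Pre- and post-conditions: the leaf `inl v` is the flexible variable `v`, the leaf `inr X` is
the variable `X` of sort `data` (the countably many variables are indexed by `ℕ`). -/
abbrev StCond := Cond S (Flex ⊕ ℕ)

/-- Rely- and guarantee-conditions: `inl (inl v)` is the (current-value) flexible variable `v`,
`inl (inr v)` is the previous-value flexible variable of `v`, and `inr X` is the variable `X` of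
sort `data`. -/
abbrev LbCond := Cond S ((Flex ⊕ Flex) ⊕ ℕ)

end Terms

section Basic

variable {S : DataSig.{u}} {Flex : Type}

/-- The homomorphic extension of a valuation to data terms, with the resulting closed term over
the signature again taken as a data term. -/
def Val.app (ρ : Val S Flex) (e : DataTerm S Flex) : DataVal S := e.subst ρ

/-- A closed term over the signature as a data term. -/
def DataVal.toTerm (e : DataVal S) : DataTerm S Flex := e.rename Empty.elim

/-- `ρ[e/v]` -/
noncomputable def Val.update (ρ : Val S Flex) (v : Flex) (e : DataVal S) : Val S Flex := by
  classical exact Function.update ρ v e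

/-- The valuation `[ρ, ρ']` of current-value (by `ρ`) and previous-value (by `ρ'`) flexible
variables. -/
def Val.pair (ρ ρ' : Val S Flex) : Flex ⊕ Flex → DataVal S := Sum.elim ρ ρ'

/-- The closed substitution instance of a condition obtained by replacing each variable `X` of
sort `data` by the closed term `θ X` over the signature. -/
def Cond.inst {Y : Type} (θ : ℕ → DataVal S) (φ : Cond S (Y ⊕ ℕ)) : Cond S Y :=
  φ.subst (Sum.elim (fun y => .var y) (fun X => (θ X).rename Empty.elim))

end Basic

/-! ## Process terms -/

/-- The terms that denote atomic processes: `act a [e₁, …, eₙ]` is the data parameterized action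
`a(e₁, …, eₙ)`, which for `n = 0` is the basic action `a`, and `assign v e` is the assignment
action `v := e`. -/
inductive Action (S : DataSig.{u}) (Act Flex : Type) : Type u
  | act (a : Act) (es : List (DataTerm S Flex))
  | assign (v : Flex) (e : DataTerm S Flex)

/-- Closed terms of sort process: atomic processes, inaction, empty process, alternative
composition, sequential composition, iteration, parallel composition, left merge, communication
merge, encapsulation, guarded command and evaluation. -/
inductive Proc (S : DataSig.{u}) (Act Flex : Type) : Type (max u 1)
  | atom (α : Action S Act Flex)
  | dead
  | eps
  | alt (p q : Proc S Act Flex)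
  | seq (p q : Proc S Act Flex)
  | iter (p q : Proc S Act Flex)
  | par (p q : Proc S Act Flex)
  | lmerge (p q : Proc S Act Flex)
  | cmerge (p q : Proc S Act Flex)
  | encap (H : Set Act) (p : Proc S Act Flex)
  | guard (φ : CondTerm S Flex) (p : Proc S Act Flex)
  | eval (ρ : Val S Flex) (p : Proc S Act Flex)

/-- A commutative and associative communication function on the basic actions together with
inaction (`none`), which is strict in inaction. -/
structure Comm (Act : Type) where
  fn : Option Act → Option Act → Option Act
  comm : ∀ a b, fn a b = fn b a
  assoc : ∀ a b c, fn (fn a b) c = fn a (fn b c)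
  dead : ∀ a, fn none a = none

section Semantics

variable {S : DataSig.{u}} {Act Flex : Type}

/-! ## Structural operational semantics and bisimulation -/

/-- `ρ (φ)` holds in `D`, for a closed condition `φ`; here the valuation may also be one of
current-value and previous-value flexible variables. -/
def HoldsAt (D : DataAlg.{u, v} S) {Y : Type} (ρ : Y → DataVal S) (φ : Cond S Y) : Prop :=
  D.Holds (φ.subst ρ)

/-- Successful termination under a valuation. -/
inductive Term (D : DataAlg.{u, v} S) : Val S Flex → Proc S Act Flex → Prop
  | eps {ρ} : Term D ρ .eps
  | alt_left {ρ x y} : Term D ρ x → Term D ρ (.alt x y)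
  | alt_right {ρ x y} : Term D ρ y → Term D ρ (.alt x y)
  | seq {ρ x y} : Term D ρ x → Term D ρ y → Term D ρ (.seq x y)
  | iter {ρ x y} : Term D ρ y → Term D ρ (.iter x y)
  | par {ρ x y} : Term D ρ x → Term D ρ y → Term D ρ (.par x y)
  | encap {ρ H x} : Term D ρ x → Term D ρ (.encap H x)
  | guard {ρ φ x} : Term D ρ x → HoldsAt D ρ φ → Term D ρ (.guard φ x)
  | eval {ρ ρ' x} : Term D ρ x → Term D ρ' (.eval ρ x)

/-- `MayComm D γ ρ α β δ`: under `ρ`, the actions `α = a(e₁, …, eₙ)` and `β = b(e₁', …, eₙ')`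
can be performed synchronously, resulting in the action `δ = c(e₁, …, eₙ)`. This requires that
`a` and `b` communicate to `c` and that corresponding data are equal. -/
inductive MayComm (D : DataAlg.{u, v} S) (γ : Comm Act) (ρ : Val S Flex) :
    Action S Act Flex → Action S Act Flex → Action S Act Flex → Prop
  | mk {a b c : Act} {es es' : List (DataTerm S Flex)} :
      γ.fn (some a) (some b) = some c →
      List.Forall₂ (fun e e' => HoldsAt D ρ (.eqData e e')) es es' →
      MayComm D γ ρ (.act a es) (.act b es') (.act c es)

/-- The transition relation: `Step D γ ρ x α x'` is the transition from `x` to `x'` by performing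
`α` under the valuation `ρ`. -/
inductive Step (D : DataAlg.{u, v} S) (γ : Comm Act) :
    Val S Flex → Proc S Act Flex → Action S Act Flex → Proc S Act Flex → Prop
  | atom {ρ α} : Step D γ ρ (.atom α) α .eps
  | alt_left {ρ α x y x'} : Step D γ ρ x α x' → Step D γ ρ (.alt x y) α x'
  | alt_right {ρ α x y y'} : Step D γ ρ y α y' → Step D γ ρ (.alt x y) α y'
  | seq_right {ρ α x y y'} : Term D ρ x → Step D γ ρ y α y' → Step D γ ρ (.seq x y) α y'
  | seq_left {ρ α x y x'} : Step D γ ρ x α x' → Step D γ ρ (.seq x y) α (.seq x' y)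
  | iter_right {ρ α x y y'} : Step D γ ρ y α y' → Step D γ ρ (.iter x y) α y'
  | iter_left {ρ α x y x'} :
      Step D γ ρ x α x' → Step D γ ρ (.iter x y) α (.seq x' (.iter x y))
  | par_left {ρ α x y x'} : Step D γ ρ x α x' → Step D γ ρ (.par x y) α (.par x' y)
  | par_right {ρ α x y y'} : Step D γ ρ y α y' → Step D γ ρ (.par x y) α (.par x y')
  | par_comm {ρ α β δ x y x' y'} : Step D γ ρ x α x' → Step D γ ρ y β y' →
      MayComm D γ ρ α β δ → Step D γ ρ (.par x y) δ (.par x' y')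
  | lmerge {ρ α x y x'} : Step D γ ρ x α x' → Step D γ ρ (.lmerge x y) α (.par x' y)
  | cmerge {ρ α β δ x y x' y'} : Step D γ ρ x α x' → Step D γ ρ y β y' →
      MayComm D γ ρ α β δ → Step D γ ρ (.cmerge x y) δ (.par x' y')
  | encap_act {ρ H a es x x'} : Step D γ ρ x (.act a es) x' → a ∉ H →
      Step D γ ρ (.encap H x) (.act a es) (.encap H x')
  | encap_assign {ρ H v e x x'} : Step D γ ρ x (.assign v e) x' →
      Step D γ ρ (.encap H x) (.assign v e) (.encap H x')
  | guard {ρ φ α x x'} : Step D γ ρ x α x' → HoldsAt D ρ φ → Step D γ ρ (.guard φ x) α x'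
  | eval_act {ρ ρ' a es x x'} : Step D γ ρ x (.act a es) x' →
      Step D γ ρ' (.eval ρ x) (.act a (es.map fun e => DataVal.toTerm (ρ.app e))) (.eval ρ x')
  | eval_assign {ρ ρ' v e x x'} : Step D γ ρ x (.assign v e) x' →
      Step D γ ρ' (.eval ρ x) (.assign v (DataVal.toTerm (ρ.app e)))
        (.eval (ρ.update v (ρ.app e)) x')

/-- Data equivalence of actions. -/
inductive DataEquiv (D : DataAlg.{u, v} S) : Action S Act Flex → Action S Act Flex → Prop
  | act {a : Act} {es es' : List (DataTerm S Flex)} :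
      List.Forall₂ (fun e e' => D.Holds (.eqData e e')) es es' →
      DataEquiv D (.act a es) (.act a es')
  | assign {v : Flex} {e e' : DataTerm S Flex} : D.Holds (.eqData e e') →
      DataEquiv D (.assign v e) (.assign v e')

/-- Bisimulations on the closed process terms. -/
def IsBisim (D : DataAlg.{u, v} S) (γ : Comm Act)
    (B : Proc S Act Flex → Proc S Act Flex → Prop) : Prop :=
  ∀ t₁ t₂, B t₁ t₂ →
    (∀ ρ α t₁', Step D γ ρ t₁ α t₁' →
      ∃ α' t₂', DataEquiv D α α' ∧ Step D γ ρ t₂ α' t₂' ∧ B t₁' t₂') ∧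
    (∀ ρ α t₂', Step D γ ρ t₂ α t₂' →
      ∃ α' t₁', DataEquiv D α α' ∧ Step D γ ρ t₁ α' t₁' ∧ B t₁' t₂') ∧
    (∀ ρ, Term D ρ t₁ → Term D ρ t₂) ∧
    (∀ ρ, Term D ρ t₂ → Term D ρ t₁)

/-- Bisimulation equivalence, the equality of the processes denoted by closed terms. -/
def Bisim (D : DataAlg.{u, v} S) (γ : Comm Act) (t₁ t₂ : Proc S Act Flex) : Prop :=
  ∃ B, IsBisim D γ B ∧ B t₁ t₂

/-- The term `ε` itself is, in particular, equal to `ε` as a process. -/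
theorem Bisim.refl (D : DataAlg.{u, v} S) (γ : Comm Act) (t : Proc S Act Flex) :
    Bisim D γ t t := by
  have hd : ∀ α : Action S Act Flex, DataEquiv D α α := by
    intro α
    cases α with
    | act a es =>
      refine .act ?_
      induction es with
      | nil => exact .nil
      | cons e es ih => exact .cons (fun _ => rfl) ih
    | assign v e => exact .assign (fun _ => rfl)
  refine ⟨Eq, ?_, rfl⟩
  rintro t₁ _ rfl
  exact ⟨fun _ α t' h => ⟨α, t', hd α, h, rfl⟩, fun _ α t' h => ⟨α, t', hd α, h, rfl⟩,
    fun _ h => h, fun _ h => h⟩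

/-! ## Asserted processes and their truth -/

/-- Process terms in which evaluation, left merge and communication merge do not occur. -/
def Proc.IsRG : Proc S Act Flex → Prop
  | .atom _ => True
  | .dead => True
  | .eps => True
  | .alt p q => p.IsRG ∧ q.IsRG
  | .seq p q => p.IsRG ∧ q.IsRG
  | .iter p q => p.IsRG ∧ q.IsRG
  | .par p q => p.IsRG ∧ q.IsRG
  | .lmerge _ _ => False
  | .cmerge _ _ => False
  | .encap _ p => p.IsRG
  | .guard _ p => p.IsRG
  | .eval _ _ => False

/-- The step relation on pairs of a process term and a valuation. The label `some α` is a step of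
the process by performing `α`, the label `none` is a step of the environment. -/
def RGStep (D : DataAlg.{u, v} S) (γ : Comm Act) (c : Proc S Act Flex × Val S Flex)
    (l : Option (Action S Act Flex)) (c' : Proc S Act Flex × Val S Flex) : Prop :=
  c.1.IsRG ∧ c'.1.IsRG ∧
    match l with
    | some α => ∀ ρ'' : Val S Flex, Step D γ ρ'' (.eval c.2 c.1) α (.eval c'.2 c'.1)
    | none => c'.1 = c.1

/-- A computation of `p` with `len` steps. It visits the pairs `conf 0, …, conf len`, where the
`i`-th step has label `lbl i`; the values of `conf` and `lbl` at larger indices play no role. -/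
structure Computation (D : DataAlg.{u, v} S) (γ : Comm Act) (p : Proc S Act Flex) where
  len : ℕ
  conf : ℕ → Proc S Act Flex × Val S Flex
  lbl : ℕ → Option (Action S Act Flex)
  start : (conf 0).1 = p
  step : ∀ i < len, RGStep D γ (conf i) (lbl i) (conf (i + 1))

/-- The computation satisfies the assumptions: closed pre-condition `φ`, closed rely-condition
`R`. -/
def Computation.Assumes {D : DataAlg.{u, v} S} {γ : Comm Act} {p : Proc S Act Flex}
    (σ : Computation D γ p) (φ : Cond S Flex) (R : Cond S (Flex ⊕ Flex)) : Prop :=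
  HoldsAt D (σ.conf 0).2 φ ∧
    ∀ i < σ.len, σ.lbl i = none →
      HoldsAt D (Val.pair (σ.conf (i + 1)).2 (σ.conf i).2) R

/-- The computation satisfies the commitments: closed post-condition `ψ`, closed
guarantee-condition `G`. The post-condition has to hold if the process that is reached equals the
empty process. -/
def Computation.Commits {D : DataAlg.{u, v} S} {γ : Comm Act} {p : Proc S Act Flex}
    (σ : Computation D γ p) (ψ : Cond S Flex) (G : Cond S (Flex ⊕ Flex)) : Prop :=
  (Bisim D γ (σ.conf σ.len).1 .eps → HoldsAt D (σ.conf σ.len).2 ψ) ∧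
    ∀ i < σ.len, σ.lbl i ≠ none →
      HoldsAt D (Val.pair (σ.conf (i + 1)).2 (σ.conf i).2) G

/-- Truth of the asserted process `⟨R, G⟩ : {φ} p {ψ}` in the sense of partial correctness. -/
def PartiallyCorrect (D : DataAlg.{u, v} S) (γ : Comm Act) (R G : LbCond S Flex)
    (φ : StCond S Flex) (p : Proc S Act Flex) (ψ : StCond S Flex) : Prop :=
  ∀ θ : ℕ → DataVal S, ∀ σ : Computation D γ p,
    σ.Assumes (φ.inst θ) (R.inst θ) → σ.Commits (ψ.inst θ) (G.inst θ)

/-! ## The rely/guarantee logic -/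

/-- A pre- or post-condition as a rely- or guarantee-condition. -/
def Cond.now (φ : StCond S Flex) : LbCond S Flex := φ.rename (Sum.map Sum.inl id)

/-- The condition `φ` with each flexible variable replaced by its previous-value variant. -/
def Cond.before (φ : StCond S Flex) : LbCond S Flex := φ.rename (Sum.map Sum.inr id)

/-- The equation `v = e`, where `v` is a current-value flexible variable and, in `e`, each flexible
variable is replaced by its previous-value variant. -/
def eqBefore (v : Flex) (e : DataTerm S Flex) : LbCond S Flex :=
  .eqData (.var (.inl (.inl v))) (e.rename fun w => .inl (.inr w))

/-- The flexible variables that occur in a pre- or post-condition. -/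
noncomputable def Cond.flexSt (φ : StCond S Flex) : Finset Flex := by
  classical exact φ.leaves.biUnion (Sum.elim (fun v => {v}) (fun _ => ∅))

/-- The flexible variables `v` such that `v` or its previous-value variant occurs in a rely- or
guarantee-condition. -/
noncomputable def Cond.flexLb (R : LbCond S Flex) : Finset Flex := by
  classical exact R.leaves.biUnion (Sum.elim (Sum.elim (fun v => {v}) (fun v => {v})) (fun _ => ∅))

/-- The condition that the flexible variables from `V` are unchanged. -/
noncomputable def unch (V : Finset Flex) : LbCond S Flex :=
  V.toList.foldr (fun v φ => (eqBefore v (.var v)).and φ) .tru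

/-- `flexSt φ ∪ flexLb G` -/
noncomputable def flexOf (φ : StCond S Flex) (G : LbCond S Flex) : Finset Flex := by
  classical exact φ.flexSt ∪ G.flexLb

/-- `flexSt φ ∪ flexLb G` without `v` -/
noncomputable def flexOfExcept (φ : StCond S Flex) (G : LbCond S Flex) (v : Flex) :
    Finset Flex := by
  classical exact (flexOf φ G).erase v

/-- The condition `ψ[e/v]`. -/
noncomputable def Cond.substFlex (ψ : StCond S Flex) (v : Flex) (e : DataTerm S Flex) :
    StCond S Flex :=
  ψ.subst (Sum.elim
    (fun w => by classical exact if w = v then e.rename Sum.inl else .var (.inl w))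
    (fun X => .var (.inr X)))

/-- The flexible variable `v` occurs in a process term. -/
def Proc.Occurs (v : Flex) : Proc S Act Flex → Prop
  | .atom (.act _ es) => ∃ e ∈ es, v ∈ e.leaves
  | .atom (.assign w e) => v = w ∨ v ∈ e.leaves
  | .dead => False
  | .eps => False
  | .alt p q => p.Occurs v ∨ q.Occurs v
  | .seq p q => p.Occurs v ∨ q.Occurs v
  | .iter p q => p.Occurs v ∨ q.Occurs v
  | .par p q => p.Occurs v ∨ q.Occurs v
  | .lmerge p q => p.Occurs v ∨ q.Occurs v
  | .cmerge p q => p.Occurs v ∨ q.Occurs v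
  | .encap _ p => p.Occurs v
  | .guard φ p => v ∈ φ.leaves ∨ p.Occurs v
  | .eval _ p => p.Occurs v

/-- The flexible variables from `A` occur in a process term only in subterms of the form `v := e`
with `v ∈ A`. -/
def Proc.OnlyInAux (A : Finset Flex) : Proc S Act Flex → Prop
  | .atom (.act _ es) => ∀ e ∈ es, Disjoint e.leaves A
  | .atom (.assign w e) => w ∈ A ∨ Disjoint e.leaves A
  | .dead => True
  | .eps => True
  | .alt p q => p.OnlyInAux A ∧ q.OnlyInAux A
  | .seq p q => p.OnlyInAux A ∧ q.OnlyInAux A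
  | .iter p q => p.OnlyInAux A ∧ q.OnlyInAux A
  | .par p q => p.OnlyInAux A ∧ q.OnlyInAux A
  | .lmerge p q => p.OnlyInAux A ∧ q.OnlyInAux A
  | .cmerge p q => p.OnlyInAux A ∧ q.OnlyInAux A
  | .encap _ p => p.OnlyInAux A
  | .guard φ p => Disjoint φ.leaves A ∧ p.OnlyInAux A
  | .eval _ p => p.OnlyInAux A

/-- `A` is a set of auxiliary variables of `p`. -/
def Proc.IsAux (p : Proc S Act Flex) (A : Finset Flex) : Prop :=
  (∀ v ∈ A, p.Occurs v) ∧ p.OnlyInAux A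

/-- The process term with all subterms `v := e` with `v ∈ A` replaced by `ε`. -/
noncomputable def Proc.erase (A : Finset Flex) : Proc S Act Flex → Proc S Act Flex
  | .atom (.act a es) => .atom (.act a es)
  | .atom (.assign w e) => by classical exact if w ∈ A then .eps else .atom (.assign w e)
  | .dead => .dead
  | .eps => .eps
  | .alt p q => .alt (p.erase A) (q.erase A)
  | .seq p q => .seq (p.erase A) (q.erase A)
  | .iter p q => .iter (p.erase A) (q.erase A)
  | .par p q => .par (p.erase A) (q.erase A)
  | .lmerge p q => .lmerge (p.erase A) (q.erase A)
  | .cmerge p q => .cmerge (p.erase A) (q.erase A)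
  | .encap H p => .encap H (p.erase A)
  | .guard φ p => .guard φ (p.erase A)
  | .eval ρ p => .eval ρ (p.erase A)

/-- `∃ v₁, … ∃ vₙ, φ`, where `A = {v₁, …, vₙ}`. -/
noncomputable def Cond.exSt (A : Finset Flex) (φ : StCond S Flex) : StCond S Flex :=
  φ.exLeaves (A.toList.map Sum.inl)

/-- `∃ v₁, … ∃ vₙ, R`, where `A = {v₁, …, vₙ}`; only the current-value flexible variables are
bound. -/
noncomputable def Cond.exLb (A : Finset Flex) (R : LbCond S Flex) : LbCond S Flex :=
  R.exLeaves (A.toList.map fun v => Sum.inl (Sum.inl v))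

/-- `Preserved D φ R`: steps that satisfy `R` preserve `φ`. -/
def Preserved (D : DataAlg.{u, v} S) (φ : StCond S Flex) (R : LbCond S Flex) : Prop :=
  D.Holds ((φ.before.and R).imp φ.now)

/-- Derivability of the asserted process `⟨R, G⟩ : {φ} p {ψ}`. -/
inductive Derivable (D : DataAlg.{u, v} S) : LbCond S Flex → LbCond S Flex →
    StCond S Flex → Proc S Act Flex → StCond S Flex → Prop
  | inaction {R G : LbCond S Flex} {φ ψ : StCond S Flex} :
      Derivable D R G φ .dead ψ
  | empty {R G : LbCond S Flex} {φ : StCond S Flex} :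
      Preserved D φ R →
      Derivable D R G φ .eps φ
  | action {R G : LbCond S Flex} {φ : StCond S Flex} {a : Act} {es : List (DataTerm S Flex)} :
      Preserved D φ R →
      D.Holds ((φ.before.and (unch (flexOf φ G))).imp G) →
      Derivable D R G φ (.atom (.act a es)) φ
  | assignment {R G : LbCond S Flex} {φ ψ : StCond S Flex} {v : Flex} {e : DataTerm S Flex} :
      D.Holds (φ.imp (ψ.substFlex v e)) →
      Preserved D φ R →
      Preserved D ψ R →
      D.Holds (((φ.before.and ((eqBefore v e).or (eqBefore v (.var v)))).and
        (unch (flexOfExcept φ G v))).imp G) →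
      Derivable D R G φ (.atom (.assign v e)) ψ
  | alternative {R G : LbCond S Flex} {φ ψ : StCond S Flex} {p q : Proc S Act Flex} :
      Derivable D R G φ p ψ →
      Derivable D R G φ q ψ →
      Derivable D R G φ (.alt p q) ψ
  | sequential {R G : LbCond S Flex} {φ χ ψ : StCond S Flex} {p q : Proc S Act Flex} :
      Derivable D R G φ p χ →
      Derivable D R G χ q ψ →
      Derivable D R G φ (.seq p q) ψ
  | iteration {R G : LbCond S Flex} {φ ψ : StCond S Flex} {p q : Proc S Act Flex} :
      Derivable D R G φ p φ →
      Derivable D R G φ q ψ →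
      Derivable D R G φ (.iter p q) ψ
  | guarded {R G : LbCond S Flex} {φ ψ : StCond S Flex} {χ : CondTerm S Flex}
      {p : Proc S Act Flex} :
      Preserved D φ R →
      Derivable D R G (φ.and (χ.rename Sum.inl)) p ψ →
      Derivable D R G φ (.guard χ p) ψ
  | parallel {R G' G'' : LbCond S Flex} {φ ψ' ψ'' : StCond S Flex} {p q : Proc S Act Flex} :
      Derivable D (R.or G'') G' φ p ψ' →
      Derivable D (R.or G') G'' φ q ψ'' →
      Derivable D R (G'.or G'') φ (.par p q) (ψ'.and ψ'')
  | encapsulation {R G : LbCond S Flex} {φ ψ : StCond S Flex} {H : Set Act}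
      {p : Proc S Act Flex} :
      Derivable D R G φ p ψ →
      Derivable D R G φ (.encap H p) ψ
  | auxiliary {R R' G : LbCond S Flex} {φ φ' ψ : StCond S Flex} {p : Proc S Act Flex}
      {A : Finset Flex} :
      p.IsAux A →
      Disjoint φ.flexSt A → Disjoint ψ.flexSt A → Disjoint R.flexLb A → Disjoint G.flexLb A →
      Preserved D φ R →
      D.Holds (φ'.exSt A) →
      D.Holds (R'.exLb A) →
      Derivable D (R.and R') G (φ.and φ') p ψ →
      Derivable D R G φ (p.erase A) ψ
  | consequence {R R' G G' : LbCond S Flex} {φ φ' ψ ψ' : StCond S Flex} {p : Proc S Act Flex} :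
      D.Holds (φ.imp φ') →
      D.Holds (R.imp R') →
      D.Holds (G'.imp G) →
      D.Holds (ψ'.imp ψ) →
      Derivable D R' G' φ' p ψ' →
      Derivable D R G φ p ψ

end Semantics

end ImpProc

namespace ImpProc

universe u v

/-! ## Substitution, satisfaction and leaves -/

section Conditions

variable {S : DataSig.{u}}

/-! Partial correctness speaks of whole computations, which do not split well along the operators.
The proof replaces it by a step-indexed predicate `Safe` on a process and a valuation: termination
entails the post-condition, every rely step preserves safety, and every program step satisfies the
guarantee and leads to safety, with the index lowered by one. Only the data denoted by a valuation
matter, so rely, guarantee and post-condition become plain relations on states.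

Safety at all indices yields partial correctness (`partiallyCorrect_of_safe`): a computation is
followed step by step, and a process equal to `ε` can terminate under every valuation. Conversely,
induction on derivations (`Derivable.safe`) gives safety from the pre-condition, by one closure
property for each operator. For parallel composition, an interleaved step of one component is a rely
step of the other, and a communication changes no valuation.

The auxiliary variables rule is the hard case, because replacing an assignment by `ε` removes a
step. The erased process is simulated by the original one: the two valuations agree outside `A`, and
a termination or step of the erased process is answered by finitely many assignments to variables
from `A` followed by the same termination or action (`auxTerm_of_erase`, `auxThen_of_erase`). The
conditions `φ'_A` and `R'_A` supply auxiliary values at the start and at each environment step. As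
the post-condition and the guarantee do not mention `A`, they transfer back (`Safe.erase`). -/

/-- The assignment of data denoted by an assignment of closed terms. -/
def den (D : DataAlg.{u, v} S) {Y : Type} (ρ : Y → DataVal S) (y : Y) : D.carrier S.data :=
  (ρ y).evalIn D.interp Empty.elim

/-- This is where minimality of the algebra enters: data obtained from existential quantifiers must
be values of an actual valuation. -/
theorem exists_den_eq (D : DataAlg.{u, v} S) {Y : Type} (s : Y → D.carrier S.data) :
    ∃ ρ : Y → DataVal S, den D ρ = s := by
  choose ρ hρ using fun y => D.minimal S.data (s y)
  exact ⟨ρ, funext hρ⟩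

theorem den_pair (D : DataAlg.{u, v} S) {Flex : Type} (ρ ρ' : Val S Flex) :
    den D (Val.pair ρ ρ') = Sum.elim (den D ρ) (den D ρ') := by
  funext y
  cases y <;> rfl

theorem Tm.evalIn_subst (D : DataAlg.{u, v} S) {X Y : Type} (f : X → Tm S Y S.data)
    (env : Y → D.carrier S.data) {s : S.Srt} (t : Tm S X s) :
    (t.subst f).evalIn D.interp env =
      t.evalIn D.interp (fun x => (f x).evalIn D.interp env) := by
  induction t with
  | var x => rfl
  | op o args ih => exact congrArg (D.interp o) (funext ih)

theorem Tm.evalIn_rename (D : DataAlg.{u, v} S) {X Y : Type} (f : X → Y)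
    (env : Y → D.carrier S.data) {s : S.Srt} (t : Tm S X s) :
    (t.rename f).evalIn D.interp env = t.evalIn D.interp (fun x => env (f x)) :=
  t.evalIn_subst D _ env

theorem Tm.evalIn_congr (D : DataAlg.{u, v} S) {X : Type} {env env' : X → D.carrier S.data}
    {s : S.Srt} (t : Tm S X s) (h : ∀ x ∈ t.leaves, env x = env' x) :
    t.evalIn D.interp env = t.evalIn D.interp env' := by
  induction t with
  | var x => exact h x (by simp [Tm.leaves])
  | op o args ih =>
    refine congrArg (D.interp o) (funext fun i => ih i fun x hx => h x ?_)
    simp only [Tm.leaves, Finset.mem_biUnion]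
    exact ⟨i, Finset.mem_univ i, hx⟩

theorem Cond.sat_subst (D : DataAlg.{u, v} S) {X Y : Type} (φ : Cond S X)
    (f : X → Tm S Y S.data) (env : Y → D.carrier S.data) :
    (φ.subst f).Sat D env ↔ φ.Sat D (fun x => (f x).evalIn D.interp env) := by
  induction φ generalizing Y with
  | eqBool t t' => simp [Cond.subst, Cond.Sat, Tm.evalIn_subst]
  | eqData t t' => simp [Cond.subst, Cond.Sat, Tm.evalIn_subst]
  | fls => simp [Cond.subst, Cond.Sat]
  | neg φ ih => simp [Cond.subst, Cond.Sat, ih]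
  | or φ ψ ih ih' => simp [Cond.subst, Cond.Sat, ih, ih']
  | ex φ ih =>
    simp only [Cond.subst, Cond.Sat, ih]
    refine exists_congr fun d => iff_of_eq (congrArg (fun e => φ.Sat D e) (funext fun o => ?_))
    cases o with
    | none => rfl
    | some x => exact Tm.evalIn_rename D _ _ _

theorem Cond.sat_rename (D : DataAlg.{u, v} S) {X Y : Type} (φ : Cond S X) (f : X → Y)
    (env : Y → D.carrier S.data) :
    (φ.rename f).Sat D env ↔ φ.Sat D (fun x => env (f x)) :=
  φ.sat_subst D _ env

theorem Cond.sat_congr (D : DataAlg.{u, v} S) {X : Type} (φ : Cond S X)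
    {env env' : X → D.carrier S.data} (h : ∀ x ∈ φ.leaves, env x = env' x) :
    φ.Sat D env ↔ φ.Sat D env' := by
  induction φ with
  | eqBool t t' =>
    simp only [Cond.leaves, Finset.mem_union] at h
    simp only [Cond.Sat]
    rw [t.evalIn_congr D fun x hx => h x (.inl hx), t'.evalIn_congr D fun x hx => h x (.inr hx)]
  | eqData t t' =>
    simp only [Cond.leaves, Finset.mem_union] at h
    simp only [Cond.Sat]
    rw [t.evalIn_congr D fun x hx => h x (.inl hx), t'.evalIn_congr D fun x hx => h x (.inr hx)]
  | fls => rfl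
  | neg φ ih => exact not_congr (ih h)
  | or φ ψ ih ih' =>
    simp only [Cond.leaves, Finset.mem_union] at h
    exact or_congr (ih fun x hx => h x (.inl hx)) (ih' fun x hx => h x (.inr hx))
  | ex φ ih =>
    refine exists_congr fun d => ih fun o ho => ?_
    cases o with
    | none => rfl
    | some x => exact h x (Finset.mem_eraseNone.2 ho)

theorem Cond.sat_and (D : DataAlg.{u, v} S) {X : Type} (φ ψ : Cond S X)
    (env : X → D.carrier S.data) : (φ.and ψ).Sat D env ↔ φ.Sat D env ∧ ψ.Sat D env := by
  simp [Cond.and, Cond.Sat]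

theorem Cond.sat_imp (D : DataAlg.{u, v} S) {X : Type} (φ ψ : Cond S X)
    (env : X → D.carrier S.data) : (φ.imp ψ).Sat D env ↔ (φ.Sat D env → ψ.Sat D env) := by
  simp [Cond.imp, Cond.Sat, imp_iff_not_or]

theorem Cond.Sat.of_imp {D : DataAlg.{u, v} S} {X : Type} {φ ψ : Cond S X}
    (h : D.Holds (φ.imp ψ)) {env : X → D.carrier S.data} (hφ : φ.Sat D env) : ψ.Sat D env :=
  (φ.sat_imp D ψ env).1 (h env) hφ

theorem Cond.sat_exLeaf (D : DataAlg.{u, v} S) {X : Type} {x : X} {φ : Cond S X}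
    {env : X → D.carrier S.data} (h : (φ.exLeaf x).Sat D env) :
    ∃ env' : X → D.carrier S.data, (∀ y, y ≠ x → env' y = env y) ∧ φ.Sat D env' := by
  obtain ⟨d, hd⟩ := h
  -- The witness is fixed by the last component: it is `env` with the value at `x` changed to `d`.
  refine ⟨_, fun y hy => ?_, (φ.sat_subst D _ _).1 hd⟩
  simp [hy, Tm.evalIn]

theorem Cond.sat_exLeaves (D : DataAlg.{u, v} S) {X : Type} {xs : List X} {φ : Cond S X}
    {env : X → D.carrier S.data} (h : (φ.exLeaves xs).Sat D env) :
    ∃ env' : X → D.carrier S.data, (∀ y, y ∉ xs → env' y = env y) ∧ φ.Sat D env' := by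
  induction xs generalizing env with
  | nil => exact ⟨env, fun _ _ => rfl, h⟩
  | cons x xs ih =>
    obtain ⟨e₁, h₁, hs⟩ := Cond.sat_exLeaf D (φ := φ.exLeaves xs) h
    obtain ⟨e₂, h₂, hs₂⟩ := ih hs
    refine ⟨e₂, fun y hy => ?_, hs₂⟩
    rw [List.mem_cons, not_or] at hy
    exact (h₂ y hy.2).trans (h₁ y hy.1)

/-- No leaves remain after substitution of closed terms, so the quantifier over assignments ranges
over the single function out of `Empty`. -/
theorem holdsAt_iff (D : DataAlg.{u, v} S) {Y : Type} (ρ : Y → DataVal S) (φ : Cond S Y) :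
    HoldsAt D ρ φ ↔ φ.Sat D (den D ρ) := by
  refine ⟨fun h => (φ.sat_subst D ρ _).1 (h Empty.elim), fun h env => (φ.sat_subst D ρ env).2 ?_⟩
  rwa [Subsingleton.elim env Empty.elim]

theorem Cond.sat_inst (D : DataAlg.{u, v} S) {Y : Type} (θ : ℕ → DataVal S)
    (φ : Cond S (Y ⊕ ℕ)) (env : Y → D.carrier S.data) :
    (φ.inst θ).Sat D env ↔ φ.Sat D (Sum.elim env (den D θ)) := by
  refine (φ.sat_subst D _ _).trans
    (iff_of_eq (congrArg (fun e => φ.Sat D e) (funext fun y => ?_)))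
  cases y with
  | inl y => rfl
  | inr n =>
    refine (Tm.evalIn_rename D _ _ _).trans ?_
    exact congrArg ((θ n).evalIn D.interp) (Subsingleton.elim _ _)

end Conditions

/-! ## Conditions as predicates on states -/

section States

variable {S : DataSig.{u}} {Flex : Type}

/-- The set of states at which a pre- or post-condition is satisfied, for given values of the data
variables. -/
def Cond.st (D : DataAlg.{u, v} S) (d : ℕ → D.carrier S.data) (φ : StCond S Flex)
    (s : Flex → D.carrier S.data) : Prop :=
  φ.Sat D (Sum.elim s d)

/-- The relation between the current and the previous state expressed by a rely- or
guarantee-condition, for given values of the data variables. -/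
def Cond.lb (D : DataAlg.{u, v} S) (d : ℕ → D.carrier S.data) (R : LbCond S Flex)
    (s s₀ : Flex → D.carrier S.data) : Prop :=
  R.Sat D (Sum.elim (Sum.elim s s₀) d)

variable (D : DataAlg.{u, v} S) (d : ℕ → D.carrier S.data)

theorem Cond.sat_now (φ : StCond S Flex) (s s₀ : Flex → D.carrier S.data) :
    φ.now.Sat D (Sum.elim (Sum.elim s s₀) d) ↔ φ.st D d s := by
  refine (φ.sat_rename D _ _).trans (iff_of_eq (congrArg (fun e => φ.Sat D e) (funext fun y => ?_)))
  cases y <;> rfl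

theorem Cond.sat_before (φ : StCond S Flex) (s s₀ : Flex → D.carrier S.data) :
    φ.before.Sat D (Sum.elim (Sum.elim s s₀) d) ↔ φ.st D d s₀ := by
  refine (φ.sat_rename D _ _).trans (iff_of_eq (congrArg (fun e => φ.Sat D e) (funext fun y => ?_)))
  cases y <;> rfl

theorem sat_eqBefore (w : Flex) (e : DataTerm S Flex) (s s₀ : Flex → D.carrier S.data) :
    (eqBefore w e).Sat D (Sum.elim (Sum.elim s s₀) d) ↔ s w = e.evalIn D.interp s₀ := by
  simp only [eqBefore, Cond.Sat, Tm.evalIn_rename, Tm.evalIn]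
  rfl

theorem sat_unch {W : Finset Flex} {s s₀ : Flex → D.carrier S.data}
    (h : ∀ w ∈ W, s w = s₀ w) : (unch W).Sat D (Sum.elim (Sum.elim s s₀) d) := by
  have h' : ∀ w ∈ W.toList, s w = s₀ w := fun w hw => h w (Finset.mem_toList.1 hw)
  unfold unch
  clear h
  -- The conjunction is a fold over this list, and the induction needs an arbitrary list.
  generalize W.toList = l at h'
  induction l with
  | nil => exact fun h => h
  | cons w l ih =>
    rw [List.foldr_cons, Cond.sat_and, sat_eqBefore]
    exact ⟨h' w (by simp), ih fun x hx => h' x (by simp [hx])⟩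

theorem Preserved.st {D : DataAlg.{u, v} S} {φ : StCond S Flex} {R : LbCond S Flex}
    (h : Preserved D φ R) (d : ℕ → D.carrier S.data) (s s₀ : Flex → D.carrier S.data)
    (hφ : φ.st D d s₀) (hR : R.lb D d s s₀) : φ.st D d s :=
  (φ.sat_now D d s s₀).1 (.of_imp h ((Cond.sat_and D _ _ _).2 ⟨(φ.sat_before D d s s₀).2 hφ, hR⟩))

theorem Cond.st_substFlex (ψ : StCond S Flex) (w : Flex) (e : DataTerm S Flex)
    (s : Flex → D.carrier S.data) [DecidableEq Flex] :
    (ψ.substFlex w e).st D d s ↔ ψ.st D d (Function.update s w (e.evalIn D.interp s)) := by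
  refine (ψ.sat_subst D _ _).trans (iff_of_eq (congrArg (fun e => ψ.Sat D e) (funext fun y => ?_)))
  cases y with
  | inl x =>
    by_cases hx : x = w
    · subst hx
      simp only [Sum.elim_inl, if_true, Function.update_self]
      exact Tm.evalIn_rename D _ _ _
    · simp [hx, Tm.evalIn]
  | inr n => rfl

theorem Cond.st_congr {φ : StCond S Flex} {A : Finset Flex} (hA : Disjoint φ.flexSt A)
    {s s' : Flex → D.carrier S.data} (h : ∀ w, w ∉ A → s w = s' w) :
    φ.st D d s ↔ φ.st D d s' := by
  refine φ.sat_congr D fun y hy => ?_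
  cases y with
  | inl w =>
    refine h w (Finset.disjoint_left.1 hA ?_)
    simp only [Cond.flexSt, Finset.mem_biUnion]
    exact ⟨_, hy, by simp⟩
  | inr n => rfl

theorem Cond.lb_congr {R : LbCond S Flex} {A : Finset Flex} (hA : Disjoint R.flexLb A)
    {s s' s₀ s₀' : Flex → D.carrier S.data} (h : ∀ w, w ∉ A → s w = s' w)
    (h₀ : ∀ w, w ∉ A → s₀ w = s₀' w) : R.lb D d s s₀ ↔ R.lb D d s' s₀' := by
  refine R.sat_congr D fun y hy => ?_
  rcases y with (w | w) | n
  · refine h w (Finset.disjoint_left.1 hA ?_)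
    simp only [Cond.flexLb, Finset.mem_biUnion]
    exact ⟨_, hy, by simp⟩
  · refine h₀ w (Finset.disjoint_left.1 hA ?_)
    simp only [Cond.flexLb, Finset.mem_biUnion]
    exact ⟨_, hy, by simp⟩
  · rfl

theorem exists_st_of_exSt {φ : StCond S Flex} {A : Finset Flex} (h : D.Holds (φ.exSt A))
    (s : Flex → D.carrier S.data) :
    ∃ s' : Flex → D.carrier S.data, (∀ w, w ∉ A → s' w = s w) ∧ φ.st D d s' := by
  obtain ⟨env, he, hs⟩ := Cond.sat_exLeaves D (h (Sum.elim s d))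
  refine ⟨fun w => env (.inl w), fun w hw => he _ (by simpa using hw), ?_⟩
  refine (φ.sat_congr D fun y _ => ?_).1 hs
  cases y with
  | inl w => rfl
  | inr n => exact he _ (by simp)

/-- The previous-value variables are not bound, so `s₀` is kept. This allows auxiliary values after
an environment step to be chosen when those before it are already fixed. -/
theorem exists_lb_of_exLb {R : LbCond S Flex} {A : Finset Flex} (h : D.Holds (R.exLb A))
    (s s₀ : Flex → D.carrier S.data) :
    ∃ s' : Flex → D.carrier S.data, (∀ w, w ∉ A → s' w = s w) ∧ R.lb D d s' s₀ := by
  obtain ⟨env, he, hs⟩ := Cond.sat_exLeaves D (h (Sum.elim (Sum.elim s s₀) d))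
  refine ⟨fun w => env (.inl (.inl w)), fun w hw => he _ (by simpa using hw), ?_⟩
  refine (R.sat_congr D fun y _ => ?_).1 hs
  rcases y with (w | w) | n
  · rfl
  · exact he _ (by simp)
  · exact he _ (by simp)

end States

/-! ## Safety of a process for a number of steps -/

section Safety

variable {S : DataSig.{u}} {Act Flex : Type}

/-- The valuation that results from performing an action. -/
noncomputable def Action.exec (ρ : Val S Flex) : Action S Act Flex → Val S Flex
  | .act _ _ => ρ
  | .assign w e => ρ.update w (ρ.app e)

theorem den_update (D : DataAlg.{u, v} S) [DecidableEq Flex] (ρ : Val S Flex) (w : Flex)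
    (e : DataTerm S Flex) :
    den D (ρ.update w (ρ.app e)) = Function.update (den D ρ) w (e.evalIn D.interp (den D ρ)) := by
  funext x
  by_cases hx : x = w
  · subst hx
    simp only [den, Val.update, Function.update_self, Val.app]
    exact Tm.evalIn_subst D _ _ _
  · simp [den, Val.update, hx]

/-- `p`, started with the valuation `ρ` in an environment that relies on `R`, guarantees `G` and
establishes `ψ` at each possible termination, in all computations of less than the given number of
steps. -/
def Safe (D : DataAlg.{u, v} S) (γ : Comm Act)
    (R G : (Flex → D.carrier S.data) → (Flex → D.carrier S.data) → Prop)
    (ψ : (Flex → D.carrier S.data) → Prop) : ℕ → Proc S Act Flex → Val S Flex → Prop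
  | 0, _, _ => True
  | n + 1, p, ρ =>
    (Term D ρ p → ψ (den D ρ)) ∧
    (∀ ρ' : Val S Flex, R (den D ρ') (den D ρ) → Safe D γ R G ψ n p ρ') ∧
    ∀ α p', Step D γ ρ p α p' →
      G (den D (α.exec ρ)) (den D ρ) ∧ Safe D γ R G ψ n p' (α.exec ρ)

variable {D : DataAlg.{u, v} S} {γ : Comm Act}
  {R R' G G' : (Flex → D.carrier S.data) → (Flex → D.carrier S.data) → Prop}
  {φ χ ψ ψ' : (Flex → D.carrier S.data) → Prop}

/-! ### Closure of safety under the rules for the operators -/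

theorem Safe.consequence (hR : ∀ s s₀, R s s₀ → R' s s₀) (hG : ∀ s s₀, G' s s₀ → G s s₀)
    (hψ : ∀ s, ψ' s → ψ s) {n : ℕ} {p : Proc S Act Flex} {ρ : Val S Flex}
    (h : Safe D γ R' G' ψ' n p ρ) : Safe D γ R G ψ n p ρ := by
  induction n generalizing p ρ with
  | zero => trivial
  | succ n ih =>
    exact ⟨fun ht => hψ _ (h.1 ht), fun ρ' hr => ih (h.2.1 ρ' (hR _ _ hr)), fun α p' hs =>
      ⟨hG _ _ (h.2.2 α p' hs).1, ih (h.2.2 α p' hs).2⟩⟩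

theorem Safe.dead (n : ℕ) (ρ : Val S Flex) : Safe D γ R G ψ n (.dead : Proc S Act Flex) ρ := by
  induction n generalizing ρ with
  | zero => trivial
  | succ n ih => exact ⟨nofun, fun ρ' _ => ih ρ', nofun⟩

theorem Safe.eps (hφ : ∀ s s₀, φ s₀ → R s s₀ → φ s) (n : ℕ) {ρ : Val S Flex}
    (h : φ (den D ρ)) : Safe D γ R G φ n (.eps : Proc S Act Flex) ρ := by
  induction n generalizing ρ with
  | zero => trivial
  | succ n ih => exact ⟨fun _ => h, fun ρ' hR => ih (hφ _ _ h hR), nofun⟩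

/-- The environment may interfere both before the action and after it, when `ε` is left; hence both
conditions have to be stable under the rely. -/
theorem Safe.atom (hφ : ∀ s s₀, φ s₀ → R s s₀ → φ s) (hψ : ∀ s s₀, ψ s₀ → R s s₀ → ψ s)
    {α : Action S Act Flex}
    (hα : ∀ ρ : Val S Flex, φ (den D ρ) →
      G (den D (α.exec ρ)) (den D ρ) ∧ ψ (den D (α.exec ρ)))
    (n : ℕ) {ρ : Val S Flex} (h : φ (den D ρ)) : Safe D γ R G ψ n (.atom α) ρ := by
  induction n generalizing ρ with
  | zero => trivial
  | succ n ih =>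
    refine ⟨nofun, fun ρ' hR => ih (hφ _ _ h hR), fun β p' hs => ?_⟩
    cases hs
    exact ⟨(hα ρ h).1, .eps hψ n (hα ρ h).2⟩

theorem Safe.alt {n : ℕ} {p q : Proc S Act Flex} {ρ : Val S Flex}
    (hp : Safe D γ R G ψ n p ρ) (hq : Safe D γ R G ψ n q ρ) :
    Safe D γ R G ψ n (.alt p q) ρ := by
  induction n generalizing ρ with
  | zero => trivial
  | succ n ih =>
    refine ⟨fun ht => ?_, fun ρ' hR => ih (hp.2.1 ρ' hR) (hq.2.1 ρ' hR), fun α p' hs => ?_⟩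
    · cases ht with
      | alt_left ht => exact hp.1 ht
      | alt_right ht => exact hq.1 ht
    · cases hs with
      | alt_left hs => exact hp.2.2 _ _ hs
      | alt_right hs => exact hq.2.2 _ _ hs

theorem Safe.seq {n : ℕ} {p q : Proc S Act Flex} {ρ : Val S Flex}
    (hp : Safe D γ R G χ n p ρ)
    (hq : ∀ m ≤ n, ∀ ρ : Val S Flex, χ (den D ρ) → Safe D γ R G ψ m q ρ) :
    Safe D γ R G ψ n (.seq p q) ρ := by
  induction n generalizing p ρ with
  | zero => trivial
  | succ n ih =>
    have hq' : ∀ m ≤ n, ∀ ρ : Val S Flex, χ (den D ρ) → Safe D γ R G ψ m q ρ :=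
      fun m hm => hq m (hm.trans n.le_succ)
    refine ⟨fun ht => ?_, fun ρ' hR => ih (hp.2.1 ρ' hR) hq', fun α p' hs => ?_⟩
    · cases ht with
      | seq hx hy => exact (hq _ le_rfl ρ (hp.1 hx)).1 hy
    · cases hs with
      | seq_left hs => exact ⟨(hp.2.2 _ _ hs).1, ih (hp.2.2 _ _ hs).2 hq'⟩
      -- Termination of `p` consumes no step: the first step of `q` is a step of the composition, so
      -- `q` is needed at the full index.
      | seq_right hx hs => exact (hq _ le_rfl ρ (hp.1 hx)).2.2 _ _ hs

/-- A step of `p` unfolds the iteration to `p' · (p* q)`. By then the index has dropped, so strong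
induction covers the iteration at whatever index `p'` terminates. -/
theorem Safe.iter {p q : Proc S Act Flex}
    (hφp : ∀ (n : ℕ) (ρ : Val S Flex), φ (den D ρ) → Safe D γ R G φ n p ρ)
    (hφq : ∀ (n : ℕ) (ρ : Val S Flex), φ (den D ρ) → Safe D γ R G ψ n q ρ)
    {n : ℕ} {ρ : Val S Flex} (hp : Safe D γ R G φ n p ρ) (hq : Safe D γ R G ψ n q ρ) :
    Safe D γ R G ψ n (.iter p q) ρ := by
  induction n using Nat.strong_induction_on generalizing ρ with
  | _ n ih =>
    cases n with
    | zero => trivial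
    | succ n =>
      refine ⟨fun ht => ?_, fun ρ' hR => ih n n.lt_succ_self (hp.2.1 ρ' hR) (hq.2.1 ρ' hR),
        fun α p' hs => ?_⟩
      · cases ht with
        | iter ht => exact hq.1 ht
      · cases hs with
        | iter_right hs => exact hq.2.2 _ _ hs
        | iter_left hs =>
          exact ⟨(hp.2.2 _ _ hs).1, (hp.2.2 _ _ hs).2.seq fun m hm ρ h =>
            ih m (Nat.lt_succ_of_le hm) (hφp m ρ h) (hφq m ρ h)⟩

/-- The guard is tested only at the first step or termination. Environment steps before that leave
the guarded command intact, and stability of `φ` keeps it usable. -/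
theorem Safe.guard {c : CondTerm S Flex} {p : Proc S Act Flex}
    (hφ : ∀ s s₀, φ s₀ → R s s₀ → φ s)
    (hp : ∀ (n : ℕ) (ρ : Val S Flex), φ (den D ρ) → HoldsAt D ρ c → Safe D γ R G ψ n p ρ)
    (n : ℕ) {ρ : Val S Flex} (h : φ (den D ρ)) : Safe D γ R G ψ n (.guard c p) ρ := by
  induction n generalizing ρ with
  | zero => trivial
  | succ n ih =>
    refine ⟨fun ht => ?_, fun ρ' hR => ih (hφ _ _ h hR), fun α p' hs => ?_⟩
    · cases ht with
      | guard ht hc => exact (hp (n + 1) ρ h hc).1 ht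
    · cases hs with
      | guard hs hc => exact (hp (n + 1) ρ h hc).2.2 _ _ hs

theorem Safe.encap {H : Set Act} {n : ℕ} {p : Proc S Act Flex} {ρ : Val S Flex}
    (hp : Safe D γ R G ψ n p ρ) : Safe D γ R G ψ n (.encap H p) ρ := by
  induction n generalizing p ρ with
  | zero => trivial
  | succ n ih =>
    refine ⟨fun ht => ?_, fun ρ' hR => ih (hp.2.1 ρ' hR), fun α p' hs => ?_⟩
    · cases ht with
      | encap ht => exact hp.1 ht
    · cases hs with
      | encap_act hs _ => exact ⟨(hp.2.2 _ _ hs).1, ih (hp.2.2 _ _ hs).2⟩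
      | encap_assign hs => exact ⟨(hp.2.2 _ _ hs).1, ih (hp.2.2 _ _ hs).2⟩

theorem Safe.par {n : ℕ} {p q : Proc S Act Flex} {ρ : Val S Flex}
    (hp : Safe D γ (fun s s₀ => R s s₀ ∨ G' s s₀) G ψ n p ρ)
    (hq : Safe D γ (fun s s₀ => R s s₀ ∨ G s s₀) G' ψ' n q ρ) :
    Safe D γ R (fun s s₀ => G s s₀ ∨ G' s s₀) (fun s => ψ s ∧ ψ' s) n (.par p q) ρ := by
  induction n generalizing p q ρ with
  | zero => trivial
  | succ n ih =>
    refine ⟨fun ht => ?_, fun ρ' hR => ih (hp.2.1 ρ' (.inl hR)) (hq.2.1 ρ' (.inl hR)),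
      fun α p' hs => ?_⟩
    · cases ht with
      | par hx hy => exact ⟨hp.1 hx, hq.1 hy⟩
    · cases hs with
      | par_left hs =>
        obtain ⟨hG, hs⟩ := hp.2.2 _ _ hs
        exact ⟨.inl hG, ih hs (hq.2.1 _ (.inr hG))⟩
      | par_right hs =>
        obtain ⟨hG, hs⟩ := hq.2.2 _ _ hs
        exact ⟨.inr hG, ih (hp.2.1 _ (.inr hG)) hs⟩
      | par_comm hx hy hc =>
        -- Only data parameterized actions communicate, so the valuation is unchanged, neither
        -- component sees an environment step, and the guarantee of one of them suffices.
        cases hc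
        exact ⟨.inl (hp.2.2 _ _ hx).1, ih (hp.2.2 _ _ hx).2 (hq.2.2 _ _ hy).2⟩

/-! ### From safety to partial correctness -/

theorem exists_step_of_eval {ρ ρ' ρ'' : Val S Flex} {p p' : Proc S Act Flex}
    {α : Action S Act Flex} (h : Step D γ ρ'' (.eval ρ p) α (.eval ρ' p')) :
    ∃ β, Step D γ ρ p β p' ∧ ρ' = β.exec ρ := by
  cases h with
  | eval_act h => exact ⟨_, h, rfl⟩
  | eval_assign h => exact ⟨_, h, rfl⟩

theorem Bisim.term_of_eps {p : Proc S Act Flex} (h : Bisim D γ p .eps) (ρ : Val S Flex) :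
    Term D ρ p := by
  obtain ⟨B, hB, hp⟩ := h
  exact (hB _ _ hp).2.2.2 ρ .eps

/-- The index exceeds the number of remaining steps by one, so that it is still positive at the end,
where the termination clause is read off. -/
theorem Computation.safe {p : Proc S Act Flex} (σ : Computation D γ p)
    (h : Safe D γ R G ψ (σ.len + 1) p (σ.conf 0).2)
    (hR : ∀ i < σ.len, σ.lbl i = none → R (den D (σ.conf (i + 1)).2) (den D (σ.conf i).2))
    {i : ℕ} (hi : i ≤ σ.len) :
    Safe D γ R G ψ (σ.len - i + 1) (σ.conf i).1 (σ.conf i).2 := by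
  induction i with
  | zero => rwa [σ.start]
  | succ i ih =>
    have hs := ih (i.le_succ.trans hi)
    rw [show σ.len - i = σ.len - (i + 1) + 1 by omega] at hs
    obtain ⟨-, -, hst⟩ := σ.step i hi
    cases hl : σ.lbl i with
    | none =>
      rw [hl] at hst
      rw [show (σ.conf (i + 1)).1 = (σ.conf i).1 from hst]
      exact hs.2.1 _ (hR i hi hl)
    | some α =>
      rw [hl] at hst
      -- The outer valuation has no influence on a step of an evaluation, so any instance serves.
      obtain ⟨β, hβ, he⟩ := exists_step_of_eval (hst (σ.conf i).2)
      rw [he]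
      exact (hs.2.2 β _ hβ).2

theorem partiallyCorrect_of_safe {R G : LbCond S Flex} {φ ψ : StCond S Flex}
    {p : Proc S Act Flex}
    (h : ∀ (d : ℕ → D.carrier S.data) (ρ : Val S Flex), φ.st D d (den D ρ) →
      ∀ n, Safe D γ (R.lb D d) (G.lb D d) (ψ.st D d) n p ρ) :
    PartiallyCorrect D γ R G φ p ψ := by
  rintro θ σ ⟨hφ, hR⟩
  have hlb (Q : LbCond S Flex) (ρ ρ' : Val S Flex) :
      HoldsAt D (Val.pair ρ ρ') (Q.inst θ) ↔ Q.lb D (den D θ) (den D ρ) (den D ρ') := by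
    rw [holdsAt_iff, Cond.sat_inst, den_pair]
    rfl
  have hst (χ : StCond S Flex) (ρ : Val S Flex) :
      HoldsAt D ρ (χ.inst θ) ↔ χ.st D (den D θ) (den D ρ) := by
    rw [holdsAt_iff, Cond.sat_inst]
    rfl
  have hs := fun i hi => σ.safe (h _ _ ((hst _ _).1 hφ) (σ.len + 1))
    (fun i hi hl => (hlb _ _ _).1 (hR i hi hl)) (i := i) hi
  refine ⟨fun hb => (hst _ _).2 ((hs _ le_rfl).1 (hb.term_of_eps _)), fun i hi hl => ?_⟩
  obtain ⟨α, hα⟩ := Option.ne_none_iff_exists'.1 hl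
  obtain ⟨-, -, hstep⟩ := σ.step i hi
  rw [hα] at hstep
  obtain ⟨β, hβ, he⟩ := exists_step_of_eval (hstep (σ.conf i).2)
  rw [hlb, he]
  exact ((hs i hi.le).2.2 β _ hβ).1

end Safety

/-! ## Erasure of assignments to auxiliary variables -/

section Auxiliary

variable {S : DataSig.{u}} {Act Flex : Type} {D : DataAlg.{u, v} S} {γ : Comm Act}
  {A : Finset Flex}

/-- An assignment to a variable from `A`, as a step on pairs of a process and a valuation. -/
def AuxStep (D : DataAlg.{u, v} S) (γ : Comm Act) (A : Finset Flex)
    (c c' : Proc S Act Flex × Val S Flex) : Prop :=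
  ∃ w ∈ A, ∃ e, Step D γ c.2 c.1 (.assign w e) c'.1 ∧ c'.2 = c.2.update w (c.2.app e)

/-- Finitely many assignments to variables from `A`. -/
abbrev AuxSteps (D : DataAlg.{u, v} S) (γ : Comm Act) (A : Finset Flex) :
    Proc S Act Flex × Val S Flex → Proc S Act Flex × Val S Flex → Prop :=
  Relation.ReflTransGen (AuxStep D γ A)

/-- The data denoted by two valuations agree on the variables outside `A`. -/
def AgreeOff (D : DataAlg.{u, v} S) (A : Finset Flex) (ρ ρ' : Val S Flex) : Prop :=
  ∀ w, w ∉ A → den D ρ w = den D ρ' w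

/-- Actions in which the variables from `A` do not occur. -/
def Action.Avoids (A : Finset Flex) : Action S Act Flex → Prop
  | .act _ es => ∀ e ∈ es, Disjoint e.leaves A
  | .assign w e => w ∉ A ∧ Disjoint e.leaves A

/-- `p` may terminate under `ρ` after assignments to variables from `A`. -/
def AuxTerm (D : DataAlg.{u, v} S) (γ : Comm Act) (A : Finset Flex) (p : Proc S Act Flex)
    (ρ : Val S Flex) : Prop :=
  ∃ c, AuxSteps D γ A (p, ρ) c ∧ Term D c.2 c.1

/-- `p` may perform `α` and become `p'` after assignments to variables from `A`. -/
def AuxThen (D : DataAlg.{u, v} S) (γ : Comm Act) (A : Finset Flex) (p : Proc S Act Flex)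
    (ρ : Val S Flex) (α : Action S Act Flex) (p' : Proc S Act Flex) : Prop :=
  ∃ c, AuxSteps D γ A (p, ρ) c ∧ Step D γ c.2 c.1 α p'

theorem Tm.evalIn_agreeOff {ρ ρ' : Val S Flex} (h : AgreeOff D A ρ ρ') {s : S.Srt}
    {t : Tm S Flex s} (ht : Disjoint t.leaves A) :
    t.evalIn D.interp (den D ρ) = t.evalIn D.interp (den D ρ') :=
  t.evalIn_congr D fun x hx => h x (Finset.disjoint_left.1 ht hx)

theorem HoldsAt.agreeOff {ρ ρ' : Val S Flex} {φ : CondTerm S Flex} (hφ : HoldsAt D ρ φ)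
    (h : AgreeOff D A ρ ρ') (hA : Disjoint φ.leaves A) : HoldsAt D ρ' φ :=
  (holdsAt_iff D ρ' φ).2 ((φ.sat_congr D fun x hx => h x (Finset.disjoint_left.1 hA hx)).1
    ((holdsAt_iff D ρ φ).1 hφ))

theorem AgreeOff.trans {ρ ρ' ρ'' : Val S Flex} (h : AgreeOff D A ρ ρ')
    (h' : AgreeOff D A ρ' ρ'') : AgreeOff D A ρ ρ'' :=
  fun w hw => (h w hw).trans (h' w hw)

theorem AgreeOff.exec {ρ ρ' : Val S Flex} (h : AgreeOff D A ρ ρ') {α : Action S Act Flex}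
    (hα : α.Avoids A) : AgreeOff D A (α.exec ρ) (α.exec ρ') := by
  classical
  cases α with
  | act a es => exact h
  | assign w e =>
    intro x hx
    simp only [Action.exec, den_update]
    by_cases hxw : x = w
    · subst hxw
      simpa using Tm.evalIn_agreeOff h hα.2
    · simpa [hxw] using h x hx

theorem AuxStep.agreeOff {c c' : Proc S Act Flex × Val S Flex} (h : AuxStep D γ A c c') :
    AgreeOff D A c.2 c'.2 := by
  classical
  obtain ⟨w, hw, e, -, he⟩ := h
  intro x hx
  have hxw : x ≠ w := fun hxw => hx (hxw ▸ hw)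
  rw [he, den_update, Function.update_of_ne hxw]

theorem AuxSteps.agreeOff {c c' : Proc S Act Flex × Val S Flex} (h : AuxSteps D γ A c c') :
    AgreeOff D A c.2 c'.2 := by
  induction h with
  | refl => exact fun _ _ => rfl
  | tail _ h ih => exact ih.trans h.agreeOff

/-- This serves contexts that persist when their argument moves, such as `· q`, `∥` and
encapsulation. Choice, guard and iteration vanish or change at the first step and need another
treatment. -/
theorem AuxSteps.map (f : Proc S Act Flex → Proc S Act Flex)
    (hf : ∀ ρ x w e x', Step D γ ρ x (.assign w e) x' → Step D γ ρ (f x) (.assign w e) (f x'))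
    {c c' : Proc S Act Flex × Val S Flex} (h : AuxSteps D γ A c c') :
    AuxSteps D γ A (f c.1, c.2) (f c'.1, c'.2) := by
  induction h with
  | refl => exact .refl
  | tail _ h ih =>
    obtain ⟨w, hw, e, hs, he⟩ := h
    exact ih.tail ⟨w, hw, e, hf _ _ _ _ _ hs, he⟩

theorem AuxTerm.of_steps {c : Proc S Act Flex × Val S Flex} {p : Proc S Act Flex}
    {ρ : Val S Flex} (h : AuxSteps D γ A (p, ρ) c) (hc : AuxTerm D γ A c.1 c.2) :
    AuxTerm D γ A p ρ := by
  obtain ⟨c', h', ht⟩ := hc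
  exact ⟨c', h.trans h', ht⟩

theorem AuxThen.of_steps {c : Proc S Act Flex × Val S Flex} {p p' : Proc S Act Flex}
    {ρ : Val S Flex} {α : Action S Act Flex} (h : AuxSteps D γ A (p, ρ) c)
    (hc : AuxThen D γ A c.1 c.2 α p') : AuxThen D γ A p ρ α p' := by
  obtain ⟨c', h', hs⟩ := hc
  exact ⟨c', h.trans h', hs⟩

/-- Potential termination is inherited by processes with more terminations and steps. -/
theorem AuxTerm.mono {p r : Proc S Act Flex} {ρ : Val S Flex} (h : AuxTerm D γ A p ρ)
    (ht : Term D ρ p → Term D ρ r)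
    (hs : ∀ α p', Step D γ ρ p α p' → Step D γ ρ r α p') : AuxTerm D γ A r ρ := by
  obtain ⟨c, h, hc⟩ := h
  -- Only the first step has to be transferred to `r`; after it the two runs coincide.
  rcases Relation.ReflTransGen.cases_head h with rfl | ⟨c₁, ⟨w, hw, e, h₁, he⟩, h⟩
  · exact ⟨_, .refl, ht hc⟩
  · exact ⟨c, .head ⟨w, hw, e, hs _ _ h₁, he⟩ h, hc⟩

/-- Potential steps are inherited by processes with more steps. -/
theorem AuxThen.mono {p r p' : Proc S Act Flex} {ρ : Val S Flex} {α : Action S Act Flex}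
    (h : AuxThen D γ A p ρ α p')
    (hs : ∀ α p', Step D γ ρ p α p' → Step D γ ρ r α p') : AuxThen D γ A r ρ α p' := by
  obtain ⟨c, h, hc⟩ := h
  rcases Relation.ReflTransGen.cases_head h with rfl | ⟨c₁, ⟨w, hw, e, h₁, he⟩, h⟩
  · exact ⟨_, .refl, hs _ _ hc⟩
  · exact ⟨c, .head ⟨w, hw, e, hs _ _ h₁, he⟩ h, hc⟩

/-! ### Invariance under steps and under changes of auxiliary values -/

theorem Step.isRG {ρ : Val S Flex} {p p' : Proc S Act Flex} {α : Action S Act Flex}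
    (h : Step D γ ρ p α p') (hp : p.IsRG) : p'.IsRG := by
  induction h with
  | atom => trivial
  | alt_left _ ih => exact ih hp.1
  | alt_right _ ih => exact ih hp.2
  | seq_right _ _ ih => exact ih hp.2
  | seq_left _ ih => exact ⟨ih hp.1, hp.2⟩
  | iter_right _ ih => exact ih hp.2
  | iter_left _ ih => exact ⟨ih hp.1, hp⟩
  | par_left _ ih => exact ⟨ih hp.1, hp.2⟩
  | par_right _ ih => exact ⟨hp.1, ih hp.2⟩
  | par_comm _ _ _ ih ih' => exact ⟨ih hp.1, ih' hp.2⟩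
  | lmerge => exact hp.elim
  | cmerge => exact hp.elim
  | encap_act _ _ ih => exact ih hp
  | encap_assign _ ih => exact ih hp
  | guard _ _ ih => exact ih hp
  | eval_act => exact hp.elim
  | eval_assign => exact hp.elim

/-- The steps of a process in which the variables from `A` occur in assignments to such variables
only are assignments to such variables or avoid `A`. -/
theorem Step.onlyInAux {ρ : Val S Flex} {p p' : Proc S Act Flex} {α : Action S Act Flex}
    (h : Step D γ ρ p α p') (hp : p.IsRG) (hA : p.OnlyInAux A) :
    p'.OnlyInAux A ∧ (α.Avoids A ∨ ∃ w ∈ A, ∃ e, α = .assign w e) := by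
  induction h with
  | @atom ρ α =>
    refine ⟨trivial, ?_⟩
    cases α with
    | act a es => exact .inl hA
    | assign w e =>
      by_cases hw : w ∈ A
      · exact .inr ⟨w, hw, e, rfl⟩
      · exact .inl ⟨hw, hA.resolve_left hw⟩
  | alt_left _ ih => exact ih hp.1 hA.1
  | alt_right _ ih => exact ih hp.2 hA.2
  | seq_right _ _ ih => exact ih hp.2 hA.2
  | seq_left _ ih => exact (ih hp.1 hA.1).imp_left (⟨·, hA.2⟩)
  | iter_right _ ih => exact ih hp.2 hA.2
  | iter_left _ ih => exact (ih hp.1 hA.1).imp_left (⟨·, hA⟩)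
  | par_left _ ih => exact (ih hp.1 hA.1).imp_left (⟨·, hA.2⟩)
  | par_right _ ih => exact (ih hp.2 hA.2).imp_left (⟨hA.1, ·⟩)
  | par_comm _ _ hc ih ih' =>
    cases hc
    have h := ih hp.1 hA.1
    exact ⟨⟨h.1, (ih' hp.2 hA.2).1⟩, .inl (h.2.resolve_right (by simp))⟩
  | lmerge => exact hp.elim
  | cmerge => exact hp.elim
  | encap_act _ _ ih => exact ih hp hA
  | encap_assign _ ih => exact ih hp hA
  | guard _ _ ih => exact ih hp hA.2
  | eval_act => exact hp.elim
  | eval_assign => exact hp.elim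

theorem AuxSteps.isRG {c c' : Proc S Act Flex × Val S Flex} (h : AuxSteps D γ A c c')
    (hp : c.1.IsRG) : c'.1.IsRG := by
  induction h with
  | refl => exact hp
  | tail _ h ih =>
    obtain ⟨w, hw, e, hs, he⟩ := h
    exact hs.isRG ih

theorem AuxSteps.onlyInAux {c c' : Proc S Act Flex × Val S Flex} (h : AuxSteps D γ A c c')
    (hp : c.1.IsRG) (hA : c.1.OnlyInAux A) : c'.1.OnlyInAux A := by
  induction h with
  | refl => exact hA
  | tail h' h ih =>
    obtain ⟨w, hw, e, hs, he⟩ := h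
    exact (hs.onlyInAux (AuxSteps.isRG h' hp) ih).1

theorem Term.agreeOff {ρ ρ' : Val S Flex} {p : Proc S Act Flex} (h : Term D ρ p)
    (hA : p.OnlyInAux A) (hρ : AgreeOff D A ρ ρ') : Term D ρ' p := by
  induction h with
  | eps => exact .eps
  | alt_left _ ih => exact .alt_left (ih hA.1 hρ)
  | alt_right _ ih => exact .alt_right (ih hA.2 hρ)
  | seq _ _ ih ih' => exact .seq (ih hA.1 hρ) (ih' hA.2 hρ)
  | iter _ ih => exact .iter (ih hA.2 hρ)
  | par _ _ ih ih' => exact .par (ih hA.1 hρ) (ih' hA.2 hρ)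
  | encap _ ih => exact .encap (ih hA hρ)
  | guard _ hφ ih => exact .guard (ih hA.2 hρ) (hφ.agreeOff hρ hA.1)
  | eval h => exact .eval h

theorem MayComm.agreeOff {ρ ρ' : Val S Flex} {α β δ : Action S Act Flex}
    (h : MayComm D γ ρ α β δ) (hα : α.Avoids A) (hβ : β.Avoids A) (hρ : AgreeOff D A ρ ρ') :
    MayComm D γ ρ' α β δ ∧ δ.Avoids A := by
  classical
  cases h with
  | mk hc he =>
    refine ⟨.mk hc ?_, hα⟩
    clear hc
    induction he with
    | nil => exact .nil
    | cons h _ ih =>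
      simp only [Action.Avoids, List.forall_mem_cons] at hα hβ
      refine .cons (h.agreeOff hρ ?_) (ih hα.2 hβ.2)
      simp only [Cond.leaves]
      exact Finset.disjoint_union_left.2 ⟨hα.1, hβ.1⟩

/-- Within the RG fragment, a valuation influences steps only through guards and the equality tests
of communication, and neither mentions `A`. Labels carry unevaluated terms and thus stay the same.
-/
theorem Step.agreeOff {ρ ρ' : Val S Flex} {p p' : Proc S Act Flex} {α : Action S Act Flex}
    (h : Step D γ ρ p α p') (hp : p.IsRG) (hA : p.OnlyInAux A) (hρ : AgreeOff D A ρ ρ') :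
    Step D γ ρ' p α p' := by
  induction h with
  | atom => exact .atom
  | alt_left _ ih => exact .alt_left (ih hp.1 hA.1 hρ)
  | alt_right _ ih => exact .alt_right (ih hp.2 hA.2 hρ)
  | seq_right ht _ ih => exact .seq_right (ht.agreeOff hA.1 hρ) (ih hp.2 hA.2 hρ)
  | seq_left _ ih => exact .seq_left (ih hp.1 hA.1 hρ)
  | iter_right _ ih => exact .iter_right (ih hp.2 hA.2 hρ)
  | iter_left _ ih => exact .iter_left (ih hp.1 hA.1 hρ)
  | par_left _ ih => exact .par_left (ih hp.1 hA.1 hρ)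
  | par_right _ ih => exact .par_right (ih hp.2 hA.2 hρ)
  | par_comm h h' hc ih ih' =>
    have hc' := hc
    cases hc'
    have hα := (h.onlyInAux hp.1 hA.1).2.resolve_right (by simp)
    have hβ := (h'.onlyInAux hp.2 hA.2).2.resolve_right (by simp)
    exact .par_comm (ih hp.1 hA.1 hρ) (ih' hp.2 hA.2 hρ) (hc.agreeOff hα hβ hρ).1
  | lmerge => exact hp.elim
  | cmerge => exact hp.elim
  | encap_act _ ha ih => exact .encap_act (ih hp hA hρ) ha
  | encap_assign _ ih => exact .encap_assign (ih hp hA hρ)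
  | guard _ hφ ih => exact .guard (ih hp hA.2 hρ) (hφ.agreeOff hρ hA.1)
  | eval_act => exact hp.elim
  | eval_assign => exact hp.elim

theorem Proc.isRG_of_erase {p : Proc S Act Flex} (h : (p.erase A).IsRG) : p.IsRG := by
  induction p with
  | atom => trivial
  | dead => trivial
  | eps => trivial
  | alt p q ih ih' => exact ⟨ih h.1, ih' h.2⟩
  | seq p q ih ih' => exact ⟨ih h.1, ih' h.2⟩
  | iter p q ih ih' => exact ⟨ih h.1, ih' h.2⟩
  | par p q ih ih' => exact ⟨ih h.1, ih' h.2⟩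
  | lmerge => exact h
  | cmerge => exact h
  | encap H p ih => exact ih h
  | guard φ p ih => exact ih h
  | eval => exact h

/-! ### Simulation of the erased process by the original one -/

/-- An erased assignment terminates at once, whereas the original has to be performed first. These
assignments alter the values in `A` along the way, so the induction covers every `ρ'` that agrees
with `ρ` outside `A`. -/
theorem auxTerm_of_erase {p : Proc S Act Flex} (hp : p.IsRG) (hA : p.OnlyInAux A)
    {ρ ρ' : Val S Flex} (hρ : AgreeOff D A ρ ρ') (h : Term D ρ (p.erase A)) :
    AuxTerm D γ A p ρ' := by
  classical
  induction p generalizing ρ' with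
  | atom α =>
    cases α with
    | act a es => cases h
    | assign w e =>
      by_cases hw : w ∈ A
      · exact ⟨(.eps, ρ'.update w (ρ'.app e)), .single ⟨w, hw, e, .atom, rfl⟩, .eps⟩
      · simp only [Proc.erase, hw, if_false] at h
        cases h
  | dead => cases h
  | eps => exact ⟨_, .refl, .eps⟩
  | alt p q ih ih' =>
    cases h with
    | alt_left h => exact (ih hp.1 hA.1 hρ h).mono .alt_left fun _ _ => .alt_left
    | alt_right h => exact (ih' hp.2 hA.2 hρ h).mono .alt_right fun _ _ => .alt_right
  | seq p q ih ih' =>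
    cases h with
    | seq h h' =>
      obtain ⟨c, hc, ht⟩ := ih hp.1 hA.1 hρ h
      refine .of_steps (hc.map (.seq · q) fun _ _ _ _ _ => .seq_left) ?_
      exact (ih' hp.2 hA.2 (hρ.trans hc.agreeOff) h').mono (.seq ht) fun _ _ => .seq_right ht
  | iter p q ih ih' =>
    cases h with
    | iter h => exact (ih' hp.2 hA.2 hρ h).mono .iter fun _ _ => .iter_right
  | par p q ih ih' =>
    cases h with
    | par h h' =>
      obtain ⟨c, hc, ht⟩ := ih hp.1 hA.1 hρ h
      obtain ⟨c', hc', ht'⟩ := ih' hp.2 hA.2 (hρ.trans hc.agreeOff) h'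
      refine .of_steps (hc.map (.par · q) fun _ _ _ _ _ => .par_left) ?_
      -- Termination of the left component has to survive the assignments made by the right one.
      exact ⟨_, hc'.map (.par c.1) fun _ _ _ _ _ => .par_right,
        .par (ht.agreeOff (hc.onlyInAux hp.1 hA.1) hc'.agreeOff) ht'⟩
  | lmerge => exact hp.elim
  | cmerge => exact hp.elim
  | encap H p ih =>
    cases h with
    | encap h =>
      obtain ⟨c, hc, ht⟩ := ih hp hA hρ h
      exact ⟨_, hc.map (.encap H) fun _ _ _ _ _ => .encap_assign, .encap ht⟩
  | guard φ p ih =>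
    cases h with
    | guard h hφ =>
      have hφ' := hφ.agreeOff hρ hA.1
      exact (ih hp hA.2 hρ h).mono (.guard · hφ') fun _ _ h => .guard h hφ'
  | eval => exact hp.elim

/-- Besides the matching step, the action is shown to avoid `A`: this is what keeps the two
valuations in agreement after it is performed. -/
theorem auxThen_of_erase {p q' : Proc S Act Flex} (hp : p.IsRG) (hA : p.OnlyInAux A)
    {ρ ρ' : Val S Flex} (hρ : AgreeOff D A ρ ρ') {α : Action S Act Flex}
    (h : Step D γ ρ (p.erase A) α q') :
    α.Avoids A ∧ ∃ p', p'.erase A = q' ∧ AuxThen D γ A p ρ' α p' := by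
  classical
  induction p generalizing ρ' α q' with
  | atom β =>
    cases β with
    | act a es =>
      cases h
      exact ⟨hA, _, rfl, _, .refl, .atom⟩
    | assign w e =>
      by_cases hw : w ∈ A
      · simp only [Proc.erase, hw, if_true] at h
        cases h
      · simp only [Proc.erase, hw, if_false] at h
        cases h
        exact ⟨⟨hw, hA.resolve_left hw⟩, _, rfl, _, .refl, .atom⟩
  | dead => cases h
  | eps => cases h
  | alt p q ih ih' =>
    cases h with
    | alt_left h =>
      obtain ⟨hα, p', rfl, hs⟩ := ih hp.1 hA.1 hρ h
      exact ⟨hα, p', rfl, hs.mono fun _ _ => .alt_left⟩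
    | alt_right h =>
      obtain ⟨hα, p', rfl, hs⟩ := ih' hp.2 hA.2 hρ h
      exact ⟨hα, p', rfl, hs.mono fun _ _ => .alt_right⟩
  | seq p q ih ih' =>
    cases h with
    | seq_left h =>
      obtain ⟨hα, p', rfl, c, hc, h⟩ := ih hp.1 hA.1 hρ h
      exact ⟨hα, .seq p' q, rfl, _, hc.map (.seq · q) fun _ _ _ _ _ => .seq_left, .seq_left h⟩
    | seq_right ht h =>
      obtain ⟨c, hc, ht⟩ := auxTerm_of_erase (γ := γ) hp.1 hA.1 hρ ht
      obtain ⟨hα, p', rfl, hs⟩ := ih' hp.2 hA.2 (hρ.trans hc.agreeOff) h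
      exact ⟨hα, p', rfl, .of_steps (hc.map (.seq · q) fun _ _ _ _ _ => .seq_left)
        (hs.mono fun _ _ => .seq_right ht)⟩
  | iter p q ih ih' =>
    cases h with
    | iter_left h =>
      obtain ⟨hα, p', rfl, c, hc, h⟩ := ih hp.1 hA.1 hρ h
      refine ⟨hα, .seq p' (.iter p q), rfl, ?_⟩
      -- The first assignment, if any, unfolds the iteration; the later ones take place on the left
      -- of a sequential composition.
      rcases Relation.ReflTransGen.cases_head hc with rfl | ⟨c₁, ⟨w, hw, e, h₁, he⟩, hc⟩
      · exact ⟨_, .refl, .iter_left h⟩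
      · exact ⟨_, .head (b := (.seq c₁.1 (.iter p q), c₁.2)) ⟨w, hw, e, .iter_left h₁, he⟩
          (AuxSteps.map (.seq · (.iter p q)) (fun _ _ _ _ _ => .seq_left) hc), .seq_left h⟩
    | iter_right h =>
      obtain ⟨hα, p', rfl, hs⟩ := ih' hp.2 hA.2 hρ h
      exact ⟨hα, p', rfl, hs.mono fun _ _ => .iter_right⟩
  | par p q ih ih' =>
    cases h with
    | par_left h =>
      obtain ⟨hα, p', rfl, c, hc, h⟩ := ih hp.1 hA.1 hρ h
      exact ⟨hα, .par p' q, rfl, _, hc.map (.par · q) fun _ _ _ _ _ => .par_left, .par_left h⟩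
    | par_right h =>
      obtain ⟨hα, q', rfl, c, hc, h⟩ := ih' hp.2 hA.2 hρ h
      exact ⟨hα, .par p q', rfl, _, hc.map (.par p) fun _ _ _ _ _ => .par_right, .par_right h⟩
    | par_comm h h' hm =>
      obtain ⟨hα, p', rfl, c, hc, h⟩ := ih hp.1 hA.1 hρ h
      have hρc := hρ.trans hc.agreeOff
      obtain ⟨hβ, q', rfl, c', hc', h'⟩ := ih' hp.2 hA.2 hρc h'
      obtain ⟨hm, hδ⟩ := hm.agreeOff hα hβ (hρc.trans hc'.agreeOff)
      refine ⟨hδ, .par p' q', rfl,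
        .of_steps (hc.map (.par · q) fun _ _ _ _ _ => .par_left) ?_⟩
      -- Both components make their assignments before the joint step, so the left step is
      -- transported to the valuation left behind by the right component.
      exact ⟨_, hc'.map (.par c.1) fun _ _ _ _ _ => .par_right, .par_comm
        (h.agreeOff (hc.isRG hp.1) (hc.onlyInAux hp.1 hA.1) hc'.agreeOff) h' hm⟩
  | lmerge => exact hp.elim
  | cmerge => exact hp.elim
  | encap H p ih =>
    cases h with
    | encap_act h ha =>
      obtain ⟨hα, p', rfl, c, hc, h⟩ := ih hp hA hρ h
      exact ⟨hα, .encap H p', rfl, _, hc.map (.encap H) fun _ _ _ _ _ => .encap_assign,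
        .encap_act h ha⟩
    | encap_assign h =>
      obtain ⟨hα, p', rfl, c, hc, h⟩ := ih hp hA hρ h
      exact ⟨hα, .encap H p', rfl, _, hc.map (.encap H) fun _ _ _ _ _ => .encap_assign,
        .encap_assign h⟩
  | guard φ p ih =>
    cases h with
    | guard h hφ =>
      obtain ⟨hα, p', rfl, hs⟩ := ih hp hA.2 hρ h
      exact ⟨hα, p', rfl, hs.mono fun _ _ h => .guard h (hφ.agreeOff hρ hA.1)⟩
  | eval => exact hp.elim

theorem AuxSteps.safe {R G : (Flex → D.carrier S.data) → (Flex → D.carrier S.data) → Prop}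
    {ψ : (Flex → D.carrier S.data) → Prop} {c c' : Proc S Act Flex × Val S Flex}
    (h : AuxSteps D γ A c c') (hs : ∀ m, Safe D γ R G ψ m c.1 c.2) (m : ℕ) :
    Safe D γ R G ψ m c'.1 c'.2 := by
  induction h generalizing m with
  | refl => exact hs m
  | tail _ h ih =>
    obtain ⟨w, hw, e, h, he⟩ := h
    rw [he]
    exact ((ih (m + 1)).2.2 _ _ h).2

/-- One step of the erased process may cost the original arbitrarily many, so the original is
required to be safe at every index. The guarantees of the auxiliary assignments in between are
simply dropped. -/
theorem Safe.erase {R R' G : LbCond S Flex} {ψ : StCond S Flex} (hψ : Disjoint ψ.flexSt A)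
    (hR : Disjoint R.flexLb A) (hG : Disjoint G.flexLb A) (hR' : D.Holds (R'.exLb A))
    {d : ℕ → D.carrier S.data} {p : Proc S Act Flex} (hp : p.IsRG) (hA : p.OnlyInAux A)
    {ρ ρ' : Val S Flex} (hρ : AgreeOff D A ρ ρ')
    (h : ∀ m, Safe D γ ((R.and R').lb D d) (G.lb D d) (ψ.st D d) m p ρ') (n : ℕ) :
    Safe D γ (R.lb D d) (G.lb D d) (ψ.st D d) n (p.erase A) ρ := by
  induction n generalizing p ρ ρ' with
  | zero => trivial
  | succ n ih =>
    refine ⟨fun ht => ?_, fun ρ₁ hr => ?_, fun α q' hs => ?_⟩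
    · obtain ⟨c, hc, ht⟩ := auxTerm_of_erase (γ := γ) hp hA hρ ht
      exact (Cond.st_congr D d hψ (hρ.trans hc.agreeOff)).2 ((hc.safe h 1).1 ht)
    -- The environment step is replayed for the original process with auxiliary values chosen to
    -- satisfy `R'`; `R` carries over since it does not mention `A`.
    · obtain ⟨s, hs, hsR⟩ := exists_lb_of_exLb D d hR' (den D ρ₁) (den D ρ')
      obtain ⟨ρ₁', rfl⟩ := exists_den_eq D s
      have hρ₁ : AgreeOff D A ρ₁ ρ₁' := fun w hw => (hs w hw).symm
      refine ih hp hA hρ₁ fun m => (h (m + 1)).2.1 ρ₁' ?_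
      exact (Cond.sat_and D _ _ _).2 ⟨(Cond.lb_congr D d hR hρ₁ hρ).1 hr, hsR⟩
    · obtain ⟨hα, p', rfl, c, hc, hst⟩ := auxThen_of_erase hp hA hρ hs
      have hρc := hρ.trans hc.agreeOff
      refine ⟨(Cond.lb_congr D d hG (hρc.exec hα) hρc).2 ((hc.safe h 1).2.2 _ _ hst).1, ?_⟩
      exact ih (hst.isRG (hc.isRG hp)) (hst.onlyInAux (hc.isRG hp) (hc.onlyInAux hp hA)).1
        (hρc.exec hα) fun m => ((hc.safe h (m + 1)).2.2 _ _ hst).2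

end Auxiliary

/-! ## Soundness -/

section Soundness

variable {S : DataSig.{u}} {Act Flex : Type} {D : DataAlg.{u, v} S}

theorem Derivable.safe (γ : Comm Act) {R G : LbCond S Flex} {φ ψ : StCond S Flex}
    {p : Proc S Act Flex} (h : Derivable D R G φ p ψ) (hp : p.IsRG) (d : ℕ → D.carrier S.data)
    {ρ : Val S Flex} (hφ : φ.st D d (den D ρ)) (n : ℕ) :
    Safe D γ (R.lb D d) (G.lb D d) (ψ.st D d) n p ρ := by
  classical
  induction h generalizing ρ n with
  | inaction => exact .dead n ρ
  | empty hR => exact .eps (hR.st d) n hφ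
  | action hR hG =>
    refine .atom (hR.st d) (hR.st d) (fun ρ h => ?_) n hφ
    refine ⟨?_, h⟩
    refine .of_imp hG ((Cond.sat_and D _ _ _).2 ⟨(Cond.sat_before D d _ _ _).2 h, ?_⟩)
    exact sat_unch D d fun _ _ => rfl
  | @assignment R G φ ψ w e hψ hR hR' hG =>
    refine .atom (hR.st d) (hR'.st d) (fun ρ h => ?_) n hφ
    simp only [Action.exec, den_update]
    refine ⟨.of_imp hG ?_, (Cond.st_substFlex D d _ _ _ _).1 (.of_imp hψ h)⟩
    rw [Cond.sat_and, Cond.sat_and]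
    -- An assignment step always makes the first disjunct true, and it leaves all variables other
    -- than `w` unchanged.
    refine ⟨⟨(Cond.sat_before D d _ _ _).2 h, .inl ?_⟩, sat_unch D d fun x hx => ?_⟩
    · rw [sat_eqBefore, Function.update_self]
    · refine Function.update_of_ne (fun hxw => ?_) _ _
      subst hxw
      simp [flexOfExcept] at hx
  | alternative _ _ ih ih' => exact .alt (ih hp.1 hφ n) (ih' hp.2 hφ n)
  | sequential _ _ ih ih' => exact .seq (ih hp.1 hφ n) fun m _ _ h => ih' hp.2 h m
  | iteration _ _ ih ih' =>
    exact .iter (fun m _ h => ih hp.1 h m) (fun m _ h => ih' hp.2 h m) (ih hp.1 hφ n)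
      (ih' hp.2 hφ n)
  | guarded hR _ ih =>
    refine .guard (hR.st d) (fun m ρ h hc => ih hp ?_ m) n hφ
    refine (Cond.sat_and D _ _ _).2 ⟨h, (Cond.sat_rename D _ _ _).2 ?_⟩
    exact (holdsAt_iff D _ _).1 hc
  | parallel _ _ ih ih' =>
    -- Disjunctions of conditions unfold to disjunctions of relations; only the encoded conjunction
    -- of the post-conditions needs a conversion.
    exact (Safe.par (ih hp.1 hφ n) (ih' hp.2 hφ n)).consequence (fun _ _ h => h)
      (fun _ _ h => h) fun _ h => (Cond.sat_and D _ _ _).2 h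
  | encapsulation _ ih => exact .encap (ih hp hφ n)
  | auxiliary hA hdφ hdψ hdR hdG _ hφ' hR' _ ih =>
    -- Initial auxiliary values that satisfy `φ'`; `φ` survives the change because it does not
    -- mention `A`.
    obtain ⟨s, hs, hsφ⟩ := exists_st_of_exSt D d hφ' (den D ρ)
    obtain ⟨ρ', rfl⟩ := exists_den_eq D s
    have hρ : AgreeOff D _ ρ ρ' := fun w hw => (hs w hw).symm
    have hp' := Proc.isRG_of_erase hp
    exact .erase hdψ hdR hdG hR' hp' hA.2 hρ
      (ih hp' ((Cond.sat_and D _ _ _).2 ⟨(Cond.st_congr D d hdφ hρ).1 hφ, hsφ⟩)) n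
  | consequence hφφ' hRR' hGG' hψψ' _ ih =>
    exact (ih hp (.of_imp hφφ' hφ) n).consequence (fun _ _ => .of_imp hRR')
      (fun _ _ => .of_imp hGG') fun _ => .of_imp hψψ'

end Soundness

end ImpProc

theorem mainTheorem1 {Act Flex : Type} [Finite Act] [Countable Flex]
    (S : ImpProc.DataSig) (D : ImpProc.DataAlg S) (γ : ImpProc.Comm Act)
    (p : ImpProc.Proc S Act Flex) (hp : p.IsRG)
    (φ ψ : ImpProc.StCond S Flex) (R G : ImpProc.LbCond S Flex)
    (h : ImpProc.Derivable D R G φ p ψ) :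
    ImpProc.PartiallyCorrect D γ R G φ p ψ :=
  ImpProc.partiallyCorrect_of_safe fun d _ hφ n => h.safe γ hp d hφ n
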